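/- Let $d\ge 1$, $L>0$, $\Omega=[0,L)^d$, and let $\mathcal H=L^2_\#(\Omega)$ be the real Hilbert space of real-valued $L\mathbb Z^d$-periodic functions that are square integrable over $\Omega$, with inner product $(\cdot,\cdot)$ and norm $\|\cdot\|$. For $k\in\frac{2\pi}{L}\mathbb Z^d$ let $e_k(x)=|\Omega|^{-1/2}e^{ik\cdot x}$ and $\hat v_k=\int_\Omega \overline{e_k}\,v$. For $s\in\mathbb R$ the norm of $H^s_\#(\Omega)$ is $\|v\|_{H^s_\#}^2=\sum_k(1+|k|^2)^s|\hat v_k|^2$, where for a real linear functional $\ell$ on $H^1_\#(\Omega)$, extended complex-linearly, $\hat\ell_k=\langle \ell,\overline{e_k}\rangle$. Let $V\in L^\infty_\#(\Omega)$ with $V\ge 1$ almost everywhere, and let $A=-\Delta+V$ on $\mathcal H$ with domain $H^2_\#(\Omega)$; it is a positive self-adjoint operator with bounded inverse, and $D(A^{1/2})=H^1_\#(\Omega)$. For $N\in\mathbb N$ let $V_N$ be the space of real functions $\sum_{|k|\le 2\pi N/L}\hat v_k e_k$. Let $m\le M$ and let $(u_i,\lambda_i)\in V_N\times\mathbb R$,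 $i=m,\dots,M$, be discrete eigenpairs: $(u_i,u_j)=\delta_{ij}$ and $$(\nabla u_i,\nabla v)+(u_i,Vv)=\lambda_i\,(u_i,v)\qquad\forall v\in V_N .$$ Let $\gamma v=\sum_{i=m}^M(v,u_i)u_i$ be the density matrix, and define the residuals $$\mathrm{Res}_c=A^{1/2}\gamma-A^{-1/2}(A^{1/2}\gamma)^\dagger A^{1/2}\gamma,\qquad \mathrm{Res}_\gamma=(1-\gamma)A\gamma,$$ $$\langle\mathrm{Res}(u_i,\lambda_i),v\rangle=\lambda_i(u_i,v)-(A^{1/2}u_i,A^{1/2}v)\qquad\forall v\in H^1_\#(\Omega).$$ Let $\|B\|_{\mathfrak S_2}=\big(\sum_j\|B\phi_j\|^2\big)^{1/2}$ be the Hilbert–Schmidt norm, for any orthonormal basis $(\phi_j)$ of $\mathcal H$. Then $$\|\mathrm{Res}_c\|_{\mathfrak S_2}^2=\|A^{-1/2}\mathrm{Res}_\gamma\|_{\mathfrak S_2}^2\le\|(-\Delta+1)^{-1/2}\mathrm{Res}_\gamma\|_{\mathfrak S_2}^2$$ $$=\sum_{i=m}^M\|\mathrm{Res}(u_i,\lambda_i)\|_{H^{-1}_\#(\Omega)}^2=\sum_{i=m}^M\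 \sup_{\substack{v\in H^1_\#(\Omega)\\ \|v\|_{H^1_\#}=1}}\langle\mathrm{Res}(u_i,\lambda_i),v\rangle^2 .$$ -/

import Mathlib

open MeasureTheory
open scoped ENNReal ComplexConjugate InnerProductSpace

noncomputable section

namespace PeriodicSchrodinger

/-! ### Unbounded operators on a real Hilbert space -/

section Operators

variable {H : Type*} [NormedAddCommGroup H] [InnerProductSpace ℝ H]

/-- Value of a partially defined operator `S` at a vector `x` of its domain
(by convention `0` outside the domain). -/
def app (S : H →ₗ.[ℝ] H) (x : H) : H :=
  open Classical in if h : x ∈ S.domain then S ⟨x, h⟩ else 0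

/-- `A⁻¹ ∈ L(H)`: the bounded operator `C` such that, for all `x`, `y`, one has
`x ∈ D(A)` and `A x = y` if and only if `x = C y` (it is unique when it exists). -/
def bddInverse (A : H →ₗ.[ℝ] H) : H →L[ℝ] H :=
  open Classical in
  if h : ∃ C : H →L[ℝ] H, ∀ x y : H, (x, y) ∈ A.graph ↔ x = C y then h.choose else 0

/-- The positive square root of a bounded operator `T`: the positive self-adjoint `S ∈ L(H)` with
`S² = T` (it exists and is unique when `T` is positive and self-adjoint). -/
def posSqrt (T : H →L[ℝ] H) : H →L[ℝ] H :=
  open Classical in if h : ∃ S : H →L[ℝ] H, S.IsPositive ∧ S ∘L S = T then h.choose else 0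

/-- `A^{-1/2} = (A⁻¹)^{1/2}`, for a positive self-adjoint `A` with bounded inverse. -/
def invSqrt (A : H →ₗ.[ℝ] H) : H →L[ℝ] H := posSqrt (bddInverse A)

/-- `A^{1/2} = (A^{-1/2})⁻¹`, an operator with domain the range of `A^{-1/2}`. -/
def sqrtOp (A : H →ₗ.[ℝ] H) : H →ₗ.[ℝ] H := ((invSqrt A : H →ₗ[ℝ] H).toPMap ⊤).inverse

/-- The composition `S B ∈ L(H)` of a partially defined operator `S` with a bounded operator `B`
with values in `D(S)`, when this composition is bounded. -/
def bddComp (S : H →ₗ.[ℝ] H) (B : H →L[ℝ] H) : H →L[ℝ] H :=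
  open Classical in
  if h : ∃ C : H →L[ℝ] H, ∀ v : H, (B v, C v) ∈ S.graph then h.choose else 0

/-- The Hilbert–Schmidt norm `(∑ₖ ‖B eₖ‖²)^{1/2} ∈ [0, ∞]`, computed in the Hilbert
basis `e`. -/
def hsNorm {ι : Type*} (e : HilbertBasis ι ℝ H) (B : H →L[ℝ] H) : ℝ≥0∞ :=
  (∑' k, ‖B (e k)‖ₑ ^ 2) ^ (1 / 2 : ℝ)

/-- The density matrix `v ↦ ∑_{i=m}^M (v, uᵢ) uᵢ`. -/
def densityMatrix (u : ℕ → H) (m M : ℕ) : H →L[ℝ] H :=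
  ∑ i ∈ Finset.Icc m M, (innerSL ℝ (u i)).smulRight (u i)

/-- The cluster residual `A^{1/2} γ - A^{-1/2} (A^{1/2} γ)† A^{1/2} γ`. -/
def clusterResidual [CompleteSpace H] (A : H →ₗ.[ℝ] H) (γ : H →L[ℝ] H) : H →L[ℝ] H :=
  bddComp (sqrtOp A) γ -
    invSqrt A ∘L ContinuousLinearMap.adjoint (bddComp (sqrtOp A) γ) ∘L bddComp (sqrtOp A) γ

/-- The strong form `(1 - γ) A γ` of the cluster residual. -/
def strongResidual (A : H →ₗ.[ℝ] H) (γ : H →L[ℝ] H) : H →L[ℝ] H :=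
  (1 - γ) ∘L bddComp A γ

/-- The single eigenpair residual `v ↦ lam (u, v) - (A^{1/2} u, A^{1/2} v)`, a functional of
`v ∈ D(A^{1/2})`. -/
def residual (A : H →ₗ.[ℝ] H) (u : H) (lam : ℝ) (v : H) : ℝ :=
  lam * ⟪u, v⟫_ℝ - ⟪app (sqrtOp A) u, app (sqrtOp A) v⟫_ℝ

end Operators

/-! ### Real functions on the torus and their Fourier coefficients -/

/-- The torus `(ℝ/Lℤ)^d`; its volume is the `d`-fold product of measures of total mass `L`. -/
abbrev Torus (d : ℕ) (L : ℝ) : Type := Fin d → AddCircle L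

/-- The real space `L²_#` of the cell `[0, L)^d`. -/
abbrev L2 (d : ℕ) (L : ℝ) [Fact (0 < L)] : Type :=
  Lp ℝ 2 (volume : Measure (Torus d L))

/-- The real space `L^∞_#` of the cell `[0, L)^d`. -/
abbrev Linf (d : ℕ) (L : ℝ) [Fact (0 < L)] : Type :=
  Lp ℝ ∞ (volume : Measure (Torus d L))

section Fourier

variable {d : ℕ} {L : ℝ}

/-- The wavevector `k = (2π/L) n` of the dual lattice. -/
def waveVec (L : ℝ) (n : Fin d → ℤ) (j : Fin d) : ℝ := 2 * Real.pi / L * n j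

/-- `|k|²` for the wavevector `k = (2π/L) n`. -/
def waveSq (L : ℝ) (n : Fin d → ℤ) : ℝ := ∑ j, waveVec L n j ^ 2

/-- The planewave `e_k(x) = |Ω|^{-1/2} exp(i k · x)`, for `k = (2π/L) n` and `|Ω| = L^d`
(`fourier p x = exp(2πi p x / L)`). -/
def planewave (n : Fin d → ℤ) : C(Torus d L, ℂ) where
  toFun x := ((Real.sqrt (L ^ d))⁻¹ : ℝ) * ∏ j, fourier (n j) (x j)
  continuous_toFun := by fun_prop

variable [Fact (0 < L)]

/-- The Fourier coefficient `v̂_k = (e_k, v) = |Ω|^{-1/2} ∫ v(x) exp(-i k · x) dx`. -/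
def coeff (v : L2 d L) (n : Fin d → ℤ) : ℂ :=
  ∫ x, conj (planewave n x) * ((v x : ℝ) : ℂ)

lemma integrable_coeff (v : L2 d L) (n : Fin d → ℤ) :
    Integrable (fun x : Torus d L => conj (planewave n x) * ((v x : ℝ) : ℂ)) := by
  have hv : Integrable (fun x : Torus d L => ((v x : ℝ) : ℂ)) :=
    ((Lp.memLp v).integrable (by norm_num)).ofReal
  refine hv.bdd_mul (c := ‖(planewave n : C(Torus d L, ℂ))‖) ?_ ?_
  · exact (Complex.continuous_conj.comp (planewave n).continuous).aestronglyMeasurable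
  · refine Filter.Eventually.of_forall fun x => ?_
    simpa using (planewave n : C(Torus d L, ℂ)).norm_coe_le_norm x

lemma coeff_add (v w : L2 d L) (n : Fin d → ℤ) : coeff (v + w) n = coeff v n + coeff w n := by
  unfold coeff
  rw [← integral_add (integrable_coeff v n) (integrable_coeff w n)]
  refine integral_congr_ae ?_
  filter_upwards [Lp.coeFn_add v w] with x hx
  rw [hx]; simp [mul_add]

lemma coeff_smul (c : ℝ) (v : L2 d L) (n : Fin d → ℤ) : coeff (c • v) n = c * coeff v n := by
  unfold coeff
  rw [← integral_const_mul]
  refine integral_congr_ae ?_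
  filter_upwards [Lp.coeFn_smul c v] with x hx
  rw [hx]; simp; ring

lemma coeff_zero (n : Fin d → ℤ) : coeff (0 : L2 d L) n = 0 := by
  simpa using coeff_smul 0 (0 : L2 d L) n

/-- The pairs `(v, f)` in `L²_# × L²_#` with `f̂_k = μ_k v̂_k` for all `k`. -/
def multiplierGraph (μ : (Fin d → ℤ) → ℂ) : Submodule ℝ (L2 d L × L2 d L) where
  carrier := {p | ∀ n, coeff p.2 n = μ n * coeff p.1 n}
  add_mem' {p q} hp hq n := by
    simp only [Prod.fst_add, Prod.snd_add, coeff_add, hp n, hq n]; ring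
  zero_mem' n := by simp [coeff_zero]
  smul_mem' c p hp n := by
    simp only [Prod.smul_fst, Prod.smul_snd, coeff_smul, hp n]; ring

lemma separatesPoints_planewave :
    (Algebra.adjoin ℂ (Set.range fun n : Fin d → ℤ =>
      (⟨fun x => ∏ j, fourier (n j) (x j), by fun_prop⟩ : C(Torus d L, ℂ)))).SeparatesPoints := by
  intro x y hxy
  obtain ⟨i, hi⟩ := Function.ne_iff.mp hxy
  refine ⟨_, ⟨_, Algebra.subset_adjoin ⟨Pi.single i 1, rfl⟩, rfl⟩, ?_⟩
  have key : ∀ z : Torus d L,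
      ∏ j, fourier ((Pi.single i (1 : ℤ) : Fin d → ℤ) j) (z j) = fourier 1 (z i) := by
    intro z
    rw [Finset.prod_eq_single i]
    · simp
    · intro j _ hj
      simp [Pi.single_eq_of_ne hj]
    · simp
  simp only [ContinuousMap.coe_mk, key, fourier_one]
  intro h
  exact hi (AddCircle.injective_toCircle (Fact.out : 0 < L).ne' (Subtype.coe_injective h))

lemma span_planewave_dense :
    (Submodule.span ℂ (Set.range (planewave : (Fin d → ℤ) → C(Torus d L, ℂ)))).topologicalClosure
      = ⊤ := by
  set m : (Fin d → ℤ) → C(Torus d L, ℂ) :=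
    fun n => ⟨fun x => ∏ j, fourier (n j) (x j), by fun_prop⟩ with hm
  have hc : ((Real.sqrt (L ^ d))⁻¹ : ℝ) ≠ 0 := by
    have : 0 < L ^ d := pow_pos Fact.out d
    positivity
  have hspan : Submodule.span ℂ (Set.range m) ≤ Submodule.span ℂ (Set.range planewave) := by
    rw [Submodule.span_le]
    rintro _ ⟨n, rfl⟩
    have : m n = (((Real.sqrt (L ^ d))⁻¹ : ℝ) : ℂ)⁻¹ • (planewave n : C(Torus d L, ℂ)) := by
      ext x
      have hc' : (((Real.sqrt (L ^ d))⁻¹ : ℝ) : ℂ) ≠ 0 := by exact_mod_cast hc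
      simp only [hm, planewave, ContinuousMap.coe_mk, ContinuousMap.coe_smul, Pi.smul_apply,
        smul_eq_mul, inv_mul_cancel_left₀ hc']
    rw [this]
    exact Submodule.smul_mem _ _ (Submodule.subset_span ⟨n, rfl⟩)
  let S : StarSubalgebra ℂ C(Torus d L, ℂ) :=
    { toSubalgebra := Algebra.adjoin ℂ (Set.range m)
      star_mem' := by
        change Algebra.adjoin ℂ (Set.range m) ≤ star (Algebra.adjoin ℂ (Set.range m))
        refine Algebra.adjoin_le ?_
        rintro _ ⟨n, rfl⟩
        refine Algebra.subset_adjoin ⟨-n, ?_⟩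
        ext1 x
        simp [hm] }
  have hS : S.topologicalClosure = ⊤ :=
    ContinuousMap.starSubalgebra_topologicalClosure_eq_top_of_separatesPoints S
      separatesPoints_planewave
  have hS' : S.toSubalgebra.toSubmodule = Submodule.span ℂ (Set.range m) := by
    refine Algebra.adjoin_eq_span_of_subset _ ?_
    refine .trans (fun x => Submonoid.closure_induction (fun _ => id) ⟨0, ?_⟩ ?_)
      Submodule.subset_span
    · ext z
      simp [hm]
    · rintro _ _ _ _ ⟨p, rfl⟩ ⟨q, rfl⟩
      refine ⟨p + q, ?_⟩
      ext z
      simp [hm, fourier_apply, fourier_add', Finset.prod_mul_distrib]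
  have h1 : (Submodule.span ℂ (Set.range m)).topologicalClosure = ⊤ := by
    rw [← hS']
    exact congr_arg (Subalgebra.toSubmodule <| StarSubalgebra.toSubalgebra ·) hS
  exact top_unique (h1 ▸ Submodule.topologicalClosure_mono hspan)

/-- A function of `L²_#` is determined by its Fourier coefficients. -/
lemma eq_zero_of_coeff (v : L2 d L) (hv : ∀ n, coeff v n = 0) : v = 0 := by
  have hmem : MemLp (fun x : Torus d L => ((v x : ℝ) : ℂ)) 2 volume := (Lp.memLp v).ofReal
  set w : Lp ℂ 2 (volume : Measure (Torus d L)) := hmem.toLp _ with hw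
  have hdense : (Submodule.span ℂ (Set.range fun n : Fin d → ℤ =>
      ContinuousMap.toLp (E := ℂ) 2 (volume : Measure (Torus d L)) ℂ
        (planewave n))).topologicalClosure = ⊤ := by
    simpa only [Submodule.map_span, ContinuousLinearMap.coe_coe, ← Set.range_comp,
      Function.comp_def] using
      (ContinuousMap.toLp_denseRange ℂ (volume : Measure (Torus d L)) ℂ
        (by norm_num : (2 : ℝ≥0∞) ≠ ∞)).topologicalClosure_map_submodule span_planewave_dense
  have horth : ∀ n : Fin d → ℤ, inner ℂ (ContinuousMap.toLp (E := ℂ) 2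
      (volume : Measure (Torus d L)) ℂ (planewave n)) w = 0 := by
    intro n
    rw [← hv n, L2.inner_def, coeff]
    refine integral_congr_ae ?_
    filter_upwards [ContinuousMap.coeFn_toLp (𝕜 := ℂ) (p := 2) (volume : Measure (Torus d L))
      (planewave n : C(Torus d L, ℂ)), hmem.coeFn_toLp] with x h1 h2
    rw [h1, hw, h2, RCLike.inner_apply, mul_comm]
  have hw0 : w = 0 := by
    have hperp : w ∈ (Submodule.span ℂ (Set.range fun n : Fin d → ℤ =>
        ContinuousMap.toLp (E := ℂ) 2 (volume : Measure (Torus d L)) ℂ (planewave n)))ᗮ := by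
      rw [Submodule.mem_orthogonal]
      intro y hy
      induction hy using Submodule.span_induction with
      | mem y hy => obtain ⟨n, rfl⟩ := hy; exact horth n
      | zero => simp
      | add a b _ _ ha hb => rw [inner_add_left, ha, hb, add_zero]
      | smul c a _ ha => rw [inner_smul_left, ha, mul_zero]
    rw [Submodule.topologicalClosure_eq_top_iff.mp hdense] at hperp
    simpa using hperp
  rw [Lp.eq_zero_iff_ae_eq_zero]
  have h0 := (Lp.eq_zero_iff_ae_eq_zero).mp hw0
  filter_upwards [h0, hmem.coeFn_toLp] with x h1 h2
  rw [hw, h2] at h1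
  simpa using h1

/-- The Fourier multiplier `v ↦ ∑_k μ_k v̂_k e_k`, with its maximal domain in `L²_#`. -/
def multiplier (μ : (Fin d → ℤ) → ℂ) : L2 d L →ₗ.[ℝ] L2 d L := (multiplierGraph μ).toLinearPMap

lemma multiplierGraph_fst_eq_zero (μ : (Fin d → ℤ) → ℂ) (p : L2 d L × L2 d L)
    (hp : p ∈ multiplierGraph μ) (h0 : p.1 = 0) : p.2 = 0 :=
  eq_zero_of_coeff _ fun n => by rw [hp n, h0, coeff_zero, mul_zero]

/-- `f = μ(D) v` means that `f̂_k = μ_k v̂_k` for all `k`. -/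
lemma mem_graph_multiplier (μ : (Fin d → ℤ) → ℂ) (v f : L2 d L) :
    (v, f) ∈ (multiplier μ).graph ↔ ∀ n, coeff f n = μ n * coeff v n := by
  rw [multiplier, Submodule.toLinearPMap_graph_eq _ (multiplierGraph_fst_eq_zero μ)]
  rfl

variable (d L) in
/-- `-Δ`, with domain `H²_# = {v | ∑_k (1 + |k|²)² |v̂_k|² < ∞}`. -/
def negLaplacian : L2 d L →ₗ.[ℝ] L2 d L := multiplier fun n => (waveSq L n : ℂ)

/-- The partial derivative `∂_j` of periodic functions. -/
def partialDeriv (j : Fin d) : L2 d L →ₗ.[ℝ] L2 d L :=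
  multiplier fun n => Complex.I * (waveVec L n j : ℂ)

/-- `(∇u, ∇v) = ∑_j (∂_j u, ∂_j v)` for `u`, `v` in `H¹_#`. -/
def gradInner (u v : L2 d L) : ℝ :=
  ∑ j, ⟪app (partialDeriv j) u, app (partialDeriv j) v⟫_ℝ

/-- Multiplication of a function of `L²_#` by the bounded potential `V`. -/
def potMul (V : Linf d L) : L2 d L →ₗ[ℝ] L2 d L where
  toFun v := V • v
  map_add' v w := Lp.add_smul V v w
  map_smul' c v := Lp.smul_comm c V v |>.symm

/-- The Schrödinger operator `-Δ + V`, with domain `H²_#`. -/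
def schrodinger (V : Linf d L) : L2 d L →ₗ.[ℝ] L2 d L := potMul V +ᵥ negLaplacian d L

variable (d L) in
/-- The operator `-Δ + 1`, with domain `H²_#`. -/
def negLaplacianAddOne : L2 d L →ₗ.[ℝ] L2 d L := (LinearMap.id : L2 d L →ₗ[ℝ] L2 d L) +ᵥ negLaplacian d L

variable (L) in
/-- The norm `(∑_k (1 + |k|²)^s |c_k|²)^{1/2} ∈ [0, ∞]` of `H^s_#`, as a function of the Fourier
coefficients `c`. -/
def sobolevNorm (s : ℝ) (c : (Fin d → ℤ) → ℂ) : ℝ≥0∞ :=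
  (∑' n, ENNReal.ofReal ((1 + waveSq L n) ^ s * ‖c n‖ ^ 2)) ^ (1 / 2 : ℝ)

/-- The real part of a planewave, as an element of `L²_#`. -/
def rePlanewave (n : Fin d → ℤ) : L2 d L :=
  ContinuousMap.toLp 2 volume ℝ ⟨fun x => (planewave n x).re, by fun_prop⟩

/-- The imaginary part of a planewave, as an element of `L²_#`. -/
def imPlanewave (n : Fin d → ℤ) : L2 d L :=
  ContinuousMap.toLp 2 volume ℝ ⟨fun x => (planewave n x).im, by fun_prop⟩

/-- The Fourier coefficients of a real linear functional `ℓ` on `H¹_#`: the value of its complex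
linear extension at the complex conjugate of `e_k`. -/
def dualCoeff (ℓ : L2 d L → ℝ) (n : Fin d → ℤ) : ℂ :=
  (ℓ (rePlanewave n) : ℂ) - Complex.I * (ℓ (imPlanewave n) : ℂ)

variable (d L) in
/-- The planewave space of the real functions `∑_{|k| ≤ 2πN/L} v̂_k e_k`. -/
def planewaveSpace (N : ℕ) : Set (L2 d L) :=
  {v | ∀ n, 2 * Real.pi / L * N < Real.sqrt (waveSq L n) → coeff v n = 0}

end Fourier

end PeriodicSchrodinger

end

/-! Write `S` for `A^{-1/2}` and `B` for `(-Δ+1)^{-1/2}`. Each `u_i` lies in `V_N`, hence in the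
domain of `A`; put `f_i = A u_i`, so that `Aγ = ∑ (u_i, ·) f_i` is bounded. Since `γ = S² (Aγ)`, one
has `A^{1/2}γ = S (Aγ)`, and since `γ` is symmetric, `(A^{1/2}γ)† A^{1/2}γ = γAγ`. Thus `Res_c = S
(1-γ) Aγ` is an identity of operators (`clusterResidual_eq`), and the first equality of norms
follows.

Testing the Galerkin equations against `u_j` gives `γ f_i = λ_i u_i`, so `Res_γ = ∑ (u_i, ·) r_i`
with `r_i = f_i - λ_i u_i`. For bounded `T`, orthonormality of the `u_i` gives `‖T Res_γ‖² = ∑ ‖T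
r_i‖²` in Hilbert–Schmidt norm (`hsNorm_sq_of_orthonormal`). The residual functional is `-(r_i, ·)`
on `H¹`. As `B` is an explicit Fourier multiplier, Parseval identifies `‖B r_i‖` with its `H⁻¹`
norm, and writing `v = Bz` identifies it with the supremum (`iSup_sq_eq`).

The inequality is `‖Sx‖ ≤ ‖Bx‖`, which expresses `A ≥ -Δ+1`. It comes from
`invSqrt_of_bounded_perturbation`, which also shows that `A⁻¹` and `A^{±1/2}`, defined by choice
with default value `0`, are the intended operators: with `W = V-1 ≥ 0`, `A⁻¹ = B (1+BWB)⁻¹ B`, and a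
positive square root of it is the limit of an explicit iteration. -/

namespace PeriodicSchrodinger

/-! ### Square roots of bounded positive operators by iteration -/

section SquareRoot

variable {H : Type*} [NormedAddCommGroup H] [InnerProductSpace ℝ H]

/-- The iteration `y ↦ (x + y²) / 2`, whose limit `y` solves `(1 - y)² = 1 - x`. -/
noncomputable def sqrtIter {R : Type*} [Ring R] [Algebra ℝ R] (x : R) : ℕ → R
  | 0 => 0
  | n + 1 => (1 / 2 : ℝ) • (x + sqrtIter x n * sqrtIter x n)

/-- The iterates are polynomials in `x`. That they commute with each other allows factoring a
difference of squares in a noncommutative ring. -/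
lemma commute_sqrtIter {R : Type*} [Ring R] [Algebra ℝ R] {x z : R} (h : Commute z x) (n : ℕ) :
    Commute z (sqrtIter x n) := by
  induction n with
  | zero => exact Commute.zero_right z
  | succ n ih => exact (h.add_right (ih.mul_right ih)).smul_right _

lemma sqrtIter_one_nonneg (n : ℕ) : 0 ≤ sqrtIter (1 : ℝ) n := by
  cases n with
  | zero => exact le_rfl
  | succ n =>
    simp only [sqrtIter, smul_eq_mul]
    nlinarith [mul_self_nonneg (sqrtIter (1 : ℝ) n)]

lemma sqrtIter_one_le (n : ℕ) : sqrtIter (1 : ℝ) n ≤ 1 := by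
  induction n with
  | zero => exact zero_le_one
  | succ n ih =>
    have := sqrtIter_one_nonneg n
    simp only [sqrtIter, smul_eq_mul]
    nlinarith

variable {R : Type*} [NormedRing R] [NormedAlgebra ℝ R]

/-- Majorant method: the recursion has nonnegative coefficients, so the scalar iteration at `1`
dominates. -/
lemma norm_sqrtIter_le {x : R} (hx : ‖x‖ ≤ 1) (n : ℕ) : ‖sqrtIter x n‖ ≤ sqrtIter (1 : ℝ) n := by
  induction n with
  | zero => simp [sqrtIter]
  | succ n ih =>
    simp only [sqrtIter, norm_smul, smul_eq_mul]
    have h1 := norm_add_le x (sqrtIter x n * sqrtIter x n)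
    have h2 := norm_mul_le (sqrtIter x n) (sqrtIter x n)
    have h3 := mul_le_mul ih ih (norm_nonneg _) (sqrtIter_one_nonneg n)
    norm_num
    linarith

/-- Consecutive increments satisfy `y'' - y' = (y' + y)(y' - y) / 2`, which the scalar increments at
`1` dominate. Those telescope, giving convergence even when `‖x‖ = 1`, where no geometric rate is
available. -/
lemma norm_sqrtIter_succ_sub_le {x : R} (hx : ‖x‖ ≤ 1) (n : ℕ) :
    ‖sqrtIter x (n + 1) - sqrtIter x n‖ ≤ sqrtIter (1 : ℝ) (n + 1) - sqrtIter (1 : ℝ) n := by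
  induction n with
  | zero => simpa [sqrtIter, norm_smul] using hx
  | succ n ih =>
    have hc : Commute (sqrtIter x (n + 1)) (sqrtIter x n) :=
      commute_sqrtIter (commute_sqrtIter (Commute.refl x) _).symm n
    have key : ∀ {S : Type _} [Ring S] [Algebra ℝ S] (y : S) (m : ℕ),
        Commute (sqrtIter y (m + 1)) (sqrtIter y m) →
        sqrtIter y (m + 1 + 1) - sqrtIter y (m + 1) = (1 / 2 : ℝ) •
          ((sqrtIter y (m + 1) + sqrtIter y m) * (sqrtIter y (m + 1) - sqrtIter y m)) := by
      intro S _ _ y m hcm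
      rw [← hcm.mul_self_sub_mul_self_eq]
      conv_lhs => rw [sqrtIter, sqrtIter.eq_2 y m, ← smul_sub, add_sub_add_left_eq_sub]
      rfl
    rw [key x n hc]
    have hone : sqrtIter (1 : ℝ) (n + 1 + 1) - sqrtIter (1 : ℝ) (n + 1) = (1 / 2 : ℝ) *
        ((sqrtIter (1 : ℝ) (n + 1) + sqrtIter (1 : ℝ) n) *
          (sqrtIter (1 : ℝ) (n + 1) - sqrtIter (1 : ℝ) n)) := by
      simp only [sqrtIter, smul_eq_mul]; ring
    rw [hone, norm_smul]
    have h1 := norm_mul_le (sqrtIter x (n + 1) + sqrtIter x n)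
      (sqrtIter x (n + 1) - sqrtIter x n)
    have h2 := (norm_add_le (sqrtIter x (n + 1)) (sqrtIter x n)).trans
      (add_le_add (norm_sqrtIter_le hx (n + 1)) (norm_sqrtIter_le hx n))
    have h3 := mul_le_mul h2 ih (norm_nonneg _)
      (add_nonneg (sqrtIter_one_nonneg (n + 1)) (sqrtIter_one_nonneg n))
    norm_num at h1 h3 ⊢
    linarith

/-- In a real Banach algebra, `1 - x` has a square root when `‖x‖ ≤ 1`. -/
lemma exists_tendsto_sqrtIter [CompleteSpace R] {x : R} (hx : ‖x‖ ≤ 1) :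
    ∃ y : R, Filter.Tendsto (sqrtIter x) Filter.atTop (nhds y) ∧ ‖y‖ ≤ 1 ∧
      (1 - y) * (1 - y) = 1 - x := by
  have hmono : Monotone (sqrtIter (1 : ℝ)) := monotone_nat_of_le_succ fun n => by
    have := (norm_nonneg _).trans (norm_sqrtIter_succ_sub_le hx n)
    linarith
  have hsum : Summable fun n => sqrtIter (1 : ℝ) (n + 1) - sqrtIter (1 : ℝ) n := by
    refine summable_of_sum_range_le (c := 1) (fun n => sub_nonneg.mpr (hmono n.le_succ)) fun n => ?_
    rw [Finset.sum_range_sub]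
    simpa [sqrtIter] using sqrtIter_one_le n
  have hcau : CauchySeq (sqrtIter x) :=
    cauchySeq_of_dist_le_of_summable _ (fun n => by
      rw [dist_comm, dist_eq_norm]; exact norm_sqrtIter_succ_sub_le hx n) hsum
  obtain ⟨y, hy⟩ := cauchySeq_tendsto_of_complete hcau
  have hlim : y = (1 / 2 : ℝ) • (x + y * y) := by
    refine tendsto_nhds_unique (hy.comp (Filter.tendsto_add_atTop_nat 1)) ?_
    exact ((hy.mul hy).const_add x).const_smul _
  refine ⟨y, hy, le_of_tendsto hy.norm (Filter.Eventually.of_forall fun n =>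
    (norm_sqrtIter_le hx n).trans (sqrtIter_one_le n)), ?_⟩
  have h2 : x = y + y - y * y := by
    have : (2 : ℝ) • y = x + y * y := by
      conv_lhs => rw [hlim]
      rw [smul_smul]; norm_num
    rw [← two_smul ℝ y, this]; abel
  rw [h2]; noncomm_ring

/-- A bounded operator `T` on a real Hilbert space with `T² ≤ T` has a positive square root. -/
lemma exists_isPositive_sqrt [CompleteSpace H] {T : H →L[ℝ] H} (hT : T.IsPositive)
    (hT' : ∀ x, ‖T x‖ ^ 2 ≤ ⟪T x, x⟫_ℝ) :
    ∃ S : H →L[ℝ] H, S.IsPositive ∧ S ∘L S = T := by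
  -- `‖x - Tx‖² = ‖x‖² - 2(Tx, x) + ‖Tx‖² ≤ ‖x‖² - (Tx, x) ≤ ‖x‖²`.
  have hx : ‖1 - T‖ ≤ 1 := by
    refine ContinuousLinearMap.opNorm_le_bound _ zero_le_one fun x => ?_
    rw [one_mul]
    refine le_of_sq_le_sq ?_ (norm_nonneg x)
    have h1 := hT' x
    have h2 := hT.inner_nonneg_left x
    have h3 := norm_sub_sq_real x (T x)
    rw [real_inner_comm] at h3
    change ‖x - T x‖ ^ 2 ≤ _
    nlinarith
  obtain ⟨y, hy, hy1, hyy⟩ := exists_tendsto_sqrtIter hx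
  have hsym : ∀ n a b, ⟪sqrtIter (1 - T) n a, b⟫_ℝ = ⟪a, sqrtIter (1 - T) n b⟫_ℝ := by
    intro n
    induction n with
    | zero => intro a b; simp [sqrtIter]
    | succ n ih =>
      intro a b
      simp [sqrtIter, inner_smul_left, inner_smul_right, inner_add_left, inner_add_right,
        inner_sub_left, inner_sub_right, ih, hT.inner_left_eq_inner_right]
  have hysym : ∀ a b, ⟪y a, b⟫_ℝ = ⟪a, y b⟫_ℝ := by
    intro a b
    have happ : ∀ c, Filter.Tendsto (fun n => sqrtIter (1 - T) n c) Filter.atTop (nhds (y c)) :=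
      fun c => ((ContinuousLinearMap.apply ℝ H c).continuous.tendsto y).comp hy
    refine tendsto_nhds_unique ((happ a).inner tendsto_const_nhds) ?_
    simp only [hsym]
    exact tendsto_const_nhds.inner (happ b)
  refine ⟨1 - y, ?_, ?_⟩
  · rw [ContinuousLinearMap.isPositive_iff]
    refine ⟨fun a b => ?_, fun a => ?_⟩
    · simp [inner_sub_left, inner_sub_right, hysym]
    · have h1 := real_inner_le_norm (y a) a
      have h2 := y.le_opNorm a
      have h3 : ‖y a‖ ≤ ‖a‖ := h2.trans (mul_le_of_le_one_left (norm_nonneg _) hy1)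
      have h4 := real_inner_self_eq_norm_sq a
      simp only [_root_.sub_apply, one_apply_eq_self, inner_sub_left]
      nlinarith [norm_nonneg a]
  · change (1 - y) * (1 - y) = T
    rw [hyy]; abel

/-- Only positivity and the value of the square are used below, so uniqueness of the root is not
needed. -/
lemma posSqrt_spec {T : H →L[ℝ] H} (h : ∃ S : H →L[ℝ] H, S.IsPositive ∧ S ∘L S = T) :
    (posSqrt T).IsPositive ∧ posSqrt T ∘L posSqrt T = T := by
  rw [posSqrt, dif_pos h]; exact h.choose_spec

end SquareRoot

/-! ### Inverses and square roots of unbounded operators, residual operators -/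

section UnboundedOperators

variable {H : Type*} [NormedAddCommGroup H] [InnerProductSpace ℝ H]

lemma app_eq_of_mem_graph {S : H →ₗ.[ℝ] H} {x y : H} (h : (x, y) ∈ S.graph) : app S x = y := by
  rw [LinearPMap.mem_graph_iff] at h
  obtain ⟨z, rfl, rfl⟩ := h
  rw [app, dif_pos z.2]

lemma mem_graph_vadd (f : H →ₗ[ℝ] H) (S : H →ₗ.[ℝ] H) (x y : H) :
    (x, y) ∈ (f +ᵥ S).graph ↔ (x, y - f x) ∈ S.graph := by
  simp only [LinearPMap.mem_graph_iff]
  constructor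
  · rintro ⟨z, hz, hy⟩
    refine ⟨z, hz, ?_⟩
    rw [LinearPMap.vadd_apply] at hy
    change f z + S z = y at hy
    rw [← hy, hz, add_sub_cancel_left]
  · rintro ⟨z, hz, hy⟩
    refine ⟨z, hz, ?_⟩
    rw [LinearPMap.vadd_apply]
    change f z + S z = y
    rw [hy, hz, add_sub_cancel]

lemma bddInverse_eq {A : H →ₗ.[ℝ] H} {C : H →L[ℝ] H}
    (h : ∀ x y : H, (x, y) ∈ A.graph ↔ x = C y) : bddInverse A = C := by
  have hex : ∃ C : H →L[ℝ] H, ∀ x y : H, (x, y) ∈ A.graph ↔ x = C y := ⟨C, h⟩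
  rw [bddInverse, dif_pos hex]
  ext y
  exact ((hex.choose_spec _ y).mp ((h (C y) y).mpr rfl)).symm

/-- Injectivity makes the swapped graph single-valued, so that `LinearPMap.inverse` is a genuine
inverse. -/
lemma mem_graph_sqrtOp {A : H →ₗ.[ℝ] H} (hA : Function.Injective (invSqrt A)) (x y : H) :
    (x, y) ∈ (sqrtOp A).graph ↔ x = invSqrt A y := by
  have hker : ((invSqrt A : H →ₗ[ℝ] H).toPMap ⊤).toFun.ker = ⊥ := by
    rw [LinearMap.ker_eq_bot]
    exact fun a b hab => Subtype.ext (hA hab)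
  rw [sqrtOp, LinearPMap.inverse_graph hker]
  simp only [Submodule.mem_map, LinearPMap.mem_graph_iff, Prod.exists]
  constructor
  · rintro ⟨a, b, ⟨z, rfl, rfl⟩, h⟩
    obtain ⟨rfl, rfl⟩ := Prod.mk.inj h
    rfl
  · rintro rfl
    exact ⟨y, _, ⟨⟨y, trivial⟩, rfl, rfl⟩, rfl⟩

lemma app_sqrtOp {A : H →ₗ.[ℝ] H} (hA : Function.Injective (invSqrt A)) (y : H) :
    app (sqrtOp A) (invSqrt A y) = y :=
  app_eq_of_mem_graph ((mem_graph_sqrtOp hA _ _).mpr rfl)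

lemma mem_graph_bddComp {S : H →ₗ.[ℝ] H} {B C : H →L[ℝ] H} (h : ∀ v, (B v, C v) ∈ S.graph)
    (v : H) : (B v, bddComp S B v) ∈ S.graph := by
  have hex : ∃ C : H →L[ℝ] H, ∀ v : H, (B v, C v) ∈ S.graph := ⟨C, h⟩
  rw [bddComp, dif_pos hex]
  exact hex.choose_spec v

/-- The range of a self-adjoint `B` is contained in that of a self-adjoint `S` when
`‖B f‖ ≤ c ‖S f‖`. -/
lemma exists_eq_of_norm_le [CompleteSpace H] {B S : H →L[ℝ] H} (hB : B.IsPositive)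
    (hS : S.IsPositive) (hinj : Function.Injective S) {c : ℝ} (h : ∀ f, ‖B f‖ ≤ c * ‖S f‖)
    (x : H) : ∃ z, S z = B x := by
  let eqv := LinearEquiv.ofInjective (S : H →ₗ[ℝ] H) hinj
  have heqv : ∀ f, eqv.symm ⟨S f, f, rfl⟩ = f := fun f =>
    eqv.symm_apply_eq.mpr rfl
  -- The functional `S f ↦ (B x, f) = (x, B f)` is bounded by `‖x‖ c ‖S f‖`. Extended by Hahn–Banach
  -- and represented by `z`, it gives `(S z, f) = (z, S f) = (B x, f)`.
  let g : LinearMap.range (S : H →ₗ[ℝ] H) →ₗ[ℝ] ℝ :=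
    (innerSL ℝ (B x) : H →ₗ[ℝ] ℝ) ∘ₗ eqv.symm.toLinearMap
  have hg : ∀ y, ‖g y‖ ≤ (‖x‖ * c) * ‖y‖ := by
    rintro ⟨_, f, rfl⟩
    have : g ⟨S f, f, rfl⟩ = ⟪B x, f⟫_ℝ := by
      change ⟪B x, eqv.symm ⟨S f, f, rfl⟩⟫_ℝ = _
      rw [heqv]
    refine (congrArg norm this).trans_le ?_
    rw [hB.inner_left_eq_inner_right]
    refine (norm_inner_le_norm x (B f)).trans ?_
    rw [mul_assoc]
    exact mul_le_mul_of_nonneg_left (h f) (norm_nonneg x)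
  obtain ⟨φ, hφ, -⟩ := exists_extension_norm_eq _ (g.mkContinuous _ hg)
  refine ⟨(InnerProductSpace.toDual ℝ H).symm φ, ext_inner_right ℝ fun f => ?_⟩
  rw [hS.inner_left_eq_inner_right, InnerProductSpace.toDual_symm_apply]
  refine (hφ ⟨S f, f, rfl⟩).trans ?_
  change ⟪B x, eqv.symm ⟨S f, f, rfl⟩⟫_ℝ = _
  rw [heqv]

/-- The operators `S = A^{-1/2}` and `C = A⁻¹` obtained from `B = K^{-1/2}`, where `A = K + W`,
`K ≥ 1` and `W` is bounded and positive. -/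
theorem invSqrt_of_bounded_perturbation [CompleteSpace H] {K A : H →ₗ.[ℝ] H} {B W : H →L[ℝ] H}
    (hB : B.IsPositive) (hB1 : ∀ x, ‖B x‖ ≤ ‖x‖) (hinj : Function.Injective B)
    (hW : W.IsPositive) (hK : ∀ x y, (x, y) ∈ K.graph ↔ x = B (B y))
    (hA : ∀ x y, (x, y) ∈ A.graph ↔ (x, y - W x) ∈ K.graph) :
    (∀ x y, (x, y) ∈ A.graph ↔ x = invSqrt A (invSqrt A y)) ∧ (invSqrt A).IsPositive ∧
      Function.Injective (invSqrt A) ∧ (∀ x, ‖invSqrt A x‖ ≤ ‖B x‖) ∧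
      ∀ x, ∃ z, invSqrt A z = B x := by
  -- Formally `A = B⁻¹ T B⁻¹`, so `A⁻¹` should be `B T⁻¹ B`; coercivity `(Tx, x) ≥ ‖x‖²` makes `T`
  -- invertible.
  set T : H →L[ℝ] H := 1 + B ∘L W ∘L B with hT
  have hTx : ∀ x, T x = x + B (W (B x)) := fun x => rfl
  have hTsym : ∀ x y, ⟪T x, y⟫_ℝ = ⟪x, T y⟫_ℝ := fun x y => by
    simp only [hTx, inner_add_left, inner_add_right, hB.inner_left_eq_inner_right,
      hW.inner_left_eq_inner_right]
  have hTpos : ∀ x, ‖x‖ ^ 2 ≤ ⟪T x, x⟫_ℝ := fun x => by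
    rw [hTx, inner_add_left, hB.inner_left_eq_inner_right, real_inner_self_eq_norm_sq]
    linarith [hW.inner_nonneg_left (B x)]
  have hunit : IsUnit T := by
    refine ContinuousLinearMap.isUnit_of_forall_le_norm_inner_map T (c := 1) zero_lt_one
      fun x => ?_
    simpa using (hTpos x).trans (le_abs_self _)
  obtain ⟨U, hU⟩ := hunit
  set Ti : H →L[ℝ] H := ((U⁻¹ : (H →L[ℝ] H)ˣ) : H →L[ℝ] H)
  have hTTi : ∀ x, T (Ti x) = x := fun x => by
    have := congrArg (fun F : H →L[ℝ] H => F x) U.mul_inv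
    rw [hU] at this; exact this
  have hTiT : ∀ x, Ti (T x) = x := fun x => by
    have := congrArg (fun F : H →L[ℝ] H => F x) U.inv_mul
    rw [hU] at this; exact this
  have hTisym : ∀ x y, ⟪Ti x, y⟫_ℝ = ⟪x, Ti y⟫_ℝ := fun x y => by
    conv_lhs => rw [← hTTi y, ← hTsym, hTTi]
  have hTi : ∀ x, ‖Ti x‖ ^ 2 ≤ ⟪Ti x, x⟫_ℝ := fun x => by
    have := hTpos (Ti x)
    rwa [hTTi, real_inner_comm] at this
  have hTi1 : ∀ x, ‖Ti x‖ ≤ ‖x‖ := fun x => by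
    have h1 := hTi x
    have h2 := real_inner_le_norm (Ti x) x
    by_contra! h
    nlinarith [norm_nonneg x]
  set C : H →L[ℝ] H := B ∘L Ti ∘L B with hC
  have hCx : ∀ x, C x = B (Ti (B x)) := fun x => rfl
  have hCin : ∀ x, ⟪C x, x⟫_ℝ = ⟪Ti (B x), B x⟫_ℝ := fun x => by
    rw [hCx, hB.inner_left_eq_inner_right]
  have hCpos : C.IsPositive := by
    rw [ContinuousLinearMap.isPositive_iff]
    refine ⟨fun x y => ?_, fun x => ?_⟩
    · change ⟪C x, y⟫_ℝ = ⟪x, C y⟫_ℝ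
      rw [hCx, hCx, hB.inner_left_eq_inner_right, hTisym, hB.inner_left_eq_inner_right]
    · rw [hCin]; exact (sq_nonneg _).trans (hTi _)
  -- `C² ≤ C` is the hypothesis under which the iteration yields a square root.
  have hCC : ∀ x, ‖C x‖ ^ 2 ≤ ⟪C x, x⟫_ℝ := fun x => by
    rw [hCin]
    exact (pow_le_pow_left₀ (norm_nonneg _) (hB1 _) 2).trans (hTi _)
  have hgraph : ∀ x f, (x, f) ∈ A.graph ↔ x = C f := by
    intro x f
    rw [hA, hK]
    constructor
    · intro h
      have hy : T (B (f - W x)) = B f := by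
        rw [hTx, ← h, ← map_add, sub_add_cancel]
      rw [hCx, ← hy, hTiT, ← h]
    · intro h
      have hy : Ti (B f) = B (f - W x) := by
        have := hTTi (B f)
        rw [hTx, ← hCx, ← h] at this
        rw [map_sub, eq_sub_iff_add_eq, this]
      rw [← hy, ← hCx, ← h]
  have hsq : (invSqrt A).IsPositive ∧ invSqrt A ∘L invSqrt A = C := by
    rw [invSqrt, bddInverse_eq hgraph]
    exact posSqrt_spec (exists_isPositive_sqrt hCpos hCC)
  obtain ⟨hS, hSS⟩ := hsq
  have hSSx : ∀ x, invSqrt A (invSqrt A x) = C x := fun x => by rw [← hSS]; rfl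
  have hnorm : ∀ x, ‖invSqrt A x‖ ^ 2 = ⟪Ti (B x), B x⟫_ℝ := fun x => by
    rw [← hCin, ← hSSx, hS.inner_left_eq_inner_right, real_inner_self_eq_norm_sq]
  have hCinj : ∀ x, C x = 0 → x = 0 := fun x hx => by
    have h1 : Ti (B x) = 0 := (injective_iff_map_eq_zero B).mp hinj _ hx
    have h2 : B x = 0 := by rw [← hTTi (B x), h1, map_zero]
    exact (injective_iff_map_eq_zero B).mp hinj _ h2
  have hSinj : Function.Injective (invSqrt A) := by
    rw [injective_iff_map_eq_zero]
    intro x hx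
    exact hCinj x (by rw [← hSSx, hx, map_zero])
  refine ⟨fun x y => by rw [hgraph, hSSx], hS, hSinj, fun x => ?_, fun x => ?_⟩
  · refine le_of_sq_le_sq ?_ (norm_nonneg _)
    rw [hnorm]
    have h1 := real_inner_le_norm (Ti (B x)) (B x)
    nlinarith [hTi1 (B x), norm_nonneg (B x)]
  -- `‖B f‖ ≤ ‖T‖ ‖T⁻¹ B f‖`, while `‖T⁻¹ B f‖² ≤ (T⁻¹ B f, B f) = ‖S f‖²`.
  · refine exists_eq_of_norm_le hB hS hSinj (c := ‖T‖) (fun f => ?_) x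
    refine le_of_sq_le_sq ?_ (by positivity)
    rw [mul_pow, hnorm]
    have h1 : ‖B f‖ ≤ ‖T‖ * ‖Ti (B f)‖ := by
      conv_lhs => rw [← hTTi (B f)]
      exact T.le_opNorm _
    calc ‖B f‖ ^ 2 ≤ (‖T‖ * ‖Ti (B f)‖) ^ 2 := pow_le_pow_left₀ (norm_nonneg _) h1 2
      _ = ‖T‖ ^ 2 * ‖Ti (B f)‖ ^ 2 := mul_pow _ _ _
      _ ≤ _ := mul_le_mul_of_nonneg_left (hTi _) (by positivity)

/-- For symmetric `S`, `‖Sx‖² = (S²x, x)` depends only on `S²`, so the chosen root may be replaced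
by `B` inside norms. -/
lemma norm_invSqrt_of_sq {K : H →ₗ.[ℝ] H} {B : H →L[ℝ] H} (hB : B.IsPositive)
    (hK : ∀ x y, (x, y) ∈ K.graph ↔ x = B (B y)) (x : H) : ‖invSqrt K x‖ = ‖B x‖ := by
  have hsq : (invSqrt K).IsPositive ∧ invSqrt K ∘L invSqrt K = B ∘L B := by
    rw [invSqrt, bddInverse_eq (C := B ∘L B) hK]
    exact posSqrt_spec ⟨B, hB, rfl⟩
  have h : invSqrt K (invSqrt K x) = B (B x) := by
    rw [← ContinuousLinearMap.comp_apply, hsq.2]; rfl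
  rw [← sq_eq_sq₀ (norm_nonneg _) (norm_nonneg _), ← real_inner_self_eq_norm_sq,
    ← real_inner_self_eq_norm_sq, ← hsq.1.inner_left_eq_inner_right, h,
    hB.inner_left_eq_inner_right]

lemma densityMatrix_apply (u : ℕ → H) (m M : ℕ) (v : H) :
    densityMatrix u m M v = ∑ i ∈ Finset.Icc m M, ⟪u i, v⟫_ℝ • u i := by
  simp [densityMatrix]

lemma hsNorm_sq {ι : Type*} (e : HilbertBasis ι ℝ H) (B : H →L[ℝ] H) :
    hsNorm e B ^ 2 = ∑' k, ‖B (e k)‖ₑ ^ 2 := by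
  rw [hsNorm, ← ENNReal.rpow_natCast, ← ENNReal.rpow_mul]
  norm_num

lemma enorm_sq_eq_ofReal {E : Type*} [SeminormedAddCommGroup E] (x : E) :
    ‖x‖ₑ ^ 2 = ENNReal.ofReal (‖x‖ ^ 2) := by
  rw [ENNReal.ofReal_pow (norm_nonneg _), ofReal_norm]

/-- The Hilbert–Schmidt norm of `v ↦ ∑ᵢ (uᵢ, v) wᵢ` for an orthonormal family `u`. -/
lemma hsNorm_sq_of_orthonormal {ι : Type*} (e : HilbertBasis ι ℝ H) {B : H →L[ℝ] H}
    {s : Finset ℕ} {u w : ℕ → H}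
    (hu : ∀ i ∈ s, ∀ j ∈ s, ⟪u i, u j⟫_ℝ = if i = j then 1 else 0)
    (hB : ∀ v, B v = ∑ i ∈ s, ⟪u i, v⟫_ℝ • w i) :
    hsNorm e B ^ 2 = ∑ i ∈ s, ‖w i‖ₑ ^ 2 := by
  have hsum : HasSum (fun k => ‖B (e k)‖ ^ 2) (∑ i ∈ s, ‖w i‖ ^ 2) := by
    -- Parseval in the basis `e` for each pair `(u i, u j)`, weighted by `(w i, w j)`;
    -- orthonormality then leaves the diagonal.
    have h := hasSum_sum (s := s) fun i _ => hasSum_sum (s := s) fun j _ =>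
      (e.hasSum_inner_mul_inner (u i) (u j)).mul_right ⟪w i, w j⟫_ℝ
    have hfun : ∀ k, ‖B (e k)‖ ^ 2 = ∑ i ∈ s, ∑ j ∈ s,
        ⟪u i, e k⟫_ℝ * ⟪e k, u j⟫_ℝ * ⟪w i, w j⟫_ℝ := by
      intro k
      rw [← real_inner_self_eq_norm_sq, hB, sum_inner]
      refine Finset.sum_congr rfl fun i _ => ?_
      rw [inner_sum]
      refine Finset.sum_congr rfl fun j _ => ?_
      rw [inner_smul_left, inner_smul_right, real_inner_comm (u j) (e k)]
      simp [mul_assoc]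
    have hval : ∑ i ∈ s, ‖w i‖ ^ 2 = ∑ i ∈ s, ∑ j ∈ s, ⟪u i, u j⟫_ℝ * ⟪w i, w j⟫_ℝ := by
      refine Finset.sum_congr rfl fun i hi => ?_
      rw [Finset.sum_eq_single_of_mem i hi fun j hj hji => by
        rw [hu i hi j hj, if_neg hji.symm, zero_mul]]
      rw [hu i hi i hi, if_pos rfl, one_mul, real_inner_self_eq_norm_sq]
    simp only [hfun, hval]
    exact h
  rw [hsNorm_sq]
  simp only [enorm_sq_eq_ofReal]
  rw [← ENNReal.ofReal_tsum_of_nonneg (fun _ => sq_nonneg _) hsum.summable, hsum.tsum_eq,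
    ENNReal.ofReal_sum_of_nonneg fun _ _ => sq_nonneg _]

/-- `Res_c = A^{-1/2} Res_γ` when the `uᵢ` belong to the domain of `A`. -/
lemma clusterResidual_eq [CompleteSpace H] {A : H →ₗ.[ℝ] H}
    (hA : ∀ x y, (x, y) ∈ A.graph ↔ x = invSqrt A (invSqrt A y)) (hS : (invSqrt A).IsPositive)
    (hinj : Function.Injective (invSqrt A)) {u f : ℕ → H} {m M : ℕ}
    (hf : ∀ i ∈ Finset.Icc m M, (u i, f i) ∈ A.graph) :
    clusterResidual A (densityMatrix u m M) =
      invSqrt A ∘L strongResidual A (densityMatrix u m M) ∧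
    ∀ v, bddComp A (densityMatrix u m M) v = ∑ i ∈ Finset.Icc m M, ⟪u i, v⟫_ℝ • f i := by
  set γ := densityMatrix u m M with hγ
  set S := invSqrt A with hSdef
  let P : H →L[ℝ] H := ∑ i ∈ Finset.Icc m M, (innerSL ℝ (u i)).smulRight (f i)
  have hP : ∀ v, P v = ∑ i ∈ Finset.Icc m M, ⟪u i, v⟫_ℝ • f i := fun v => by
    simp [P]
  have hSSP : ∀ v, γ v = S (S (P v)) := fun v => by
    rw [hγ, densityMatrix_apply, hP, map_sum, map_sum]
    refine Finset.sum_congr rfl fun i hi => ?_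
    rw [map_smul, map_smul, ← (hA _ _).mp (hf i hi)]
  have hbA : ∀ v, bddComp A γ v = P v := fun v =>
    hinj (hinj (((hA _ _).mp (mem_graph_bddComp (C := P)
      (fun v => (hA _ _).mpr (hSSP v)) v)).symm.trans (hSSP v)))
  have hbS : bddComp (sqrtOp A) γ = S ∘L P := by
    ext v
    exact hinj (((mem_graph_sqrtOp hinj _ _).mp (mem_graph_bddComp (C := S ∘L P)
      (fun v => (mem_graph_sqrtOp hinj _ _).mpr (hSSP v)) v)).symm.trans (hSSP v))
  refine ⟨?_, fun v => (hbA v).trans (hP v)⟩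
  have hγsym : ∀ x y, ⟪γ x, y⟫_ℝ = ⟪x, γ y⟫_ℝ := fun x y => by
    simp only [hγ, densityMatrix_apply, sum_inner, inner_sum, inner_smul_left, inner_smul_right]
    refine Finset.sum_congr rfl fun i _ => ?_
    rw [real_inner_comm x (u i)]; simp [mul_comm]
  -- `(S P v, S P y) = (P v, S² P y) = (P v, γ y)`, and `γ` is symmetric.
  have hadj : ∀ v, ContinuousLinearMap.adjoint (S ∘L P) (S (P v)) = γ (P v) := fun v => by
    refine ext_inner_right ℝ fun y => ?_
    rw [ContinuousLinearMap.adjoint_inner_left, ContinuousLinearMap.comp_apply,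
      hS.inner_left_eq_inner_right, ← hSSP, ← hγsym]
  ext v
  simp only [clusterResidual, strongResidual, hbS, _root_.sub_apply,
    ContinuousLinearMap.comp_apply, hadj, hbA, one_apply_eq_self, map_sub]
  rfl

end UnboundedOperators

/-! ### Planewave basis, Parseval's identity and Fourier multipliers -/

section PlanewaveBasis

variable {d : ℕ} {L : ℝ}

lemma planewave_neg (n : Fin d → ℤ) (x : Torus d L) :
    planewave (-n) x = conj (planewave n x) := by
  simp [planewave]

lemma waveSq_nonneg (n : Fin d → ℤ) : 0 ≤ waveSq L n := Finset.sum_nonneg fun _ _ => sq_nonneg _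

lemma waveSq_neg (n : Fin d → ℤ) : waveSq L (-n) = waveSq L n := by
  simp [waveSq, waveVec]

lemma one_le_sqrt_waveSq (n : Fin d → ℤ) : 1 ≤ Real.sqrt (1 + waveSq L n) :=
  Real.one_le_sqrt.mpr (by linarith [waveSq_nonneg (L := L) n])

lemma sq_sqrt_waveSq (n : Fin d → ℤ) : Real.sqrt (1 + waveSq L n) ^ 2 = 1 + waveSq L n :=
  Real.sq_sqrt (by linarith [waveSq_nonneg (L := L) n])

lemma sobolevNorm_sq (s : ℝ) (c : (Fin d → ℤ) → ℂ) :
    sobolevNorm L s c ^ 2 = ∑' n, ENNReal.ofReal ((1 + waveSq L n) ^ s * ‖c n‖ ^ 2) := by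
  rw [sobolevNorm, ← ENNReal.rpow_natCast, ← ENNReal.rpow_mul]
  norm_num

variable [Fact (0 < L)]

lemma integral_fourier (n : ℤ) :
    ∫ x : AddCircle L, (fourier n x : ℂ) = if n = 0 then (L : ℂ) else 0 := by
  split_ifs with h
  · subst h
    simp [Measure.real, AddCircle.measure_univ, (Fact.out : 0 < L).le]
  · exact integral_eq_zero_of_add_right_eq_neg (fourier_add_half_inv_index h Fact.out)

lemma integral_conj_planewave_mul (n k : Fin d → ℤ) :
    ∫ x : Torus d L, conj (planewave n x) * planewave k x = if n = k then 1 else 0 := by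
  have hL : 0 < L ^ d := pow_pos Fact.out d
  have hpt : ∀ x : Torus d L, conj (planewave n x) * planewave k x =
      ((L ^ d : ℝ) : ℂ)⁻¹ * ∏ j, (fourier (k j - n j) (x j) : ℂ) := by
    intro x
    have hs : (((Real.sqrt (L ^ d))⁻¹ : ℝ) : ℂ) * (((Real.sqrt (L ^ d))⁻¹ : ℝ) : ℂ) =
        ((L ^ d : ℝ) : ℂ)⁻¹ := by
      rw [← Complex.ofReal_mul, ← mul_inv, Real.mul_self_sqrt hL.le, Complex.ofReal_inv]
    simp only [planewave, ContinuousMap.coe_mk, map_mul, Complex.conj_ofReal, map_prod,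
      ← fourier_neg, sub_eq_add_neg, fourier_add, Finset.prod_mul_distrib, ← hs]
    ring
  simp_rw [hpt]
  rw [integral_const_mul,
    integral_fintype_prod_volume_eq_prod (fun j (x : AddCircle L) => (fourier (k j - n j) x : ℂ))]
  simp_rw [integral_fourier]
  split_ifs with h
  · subst h
    have : ((L ^ d : ℝ) : ℂ) ≠ 0 := by exact_mod_cast hL.ne'
    simpa using inv_mul_cancel₀ this
  · obtain ⟨j, hj⟩ := Function.ne_iff.mp h
    rw [Finset.prod_eq_zero (Finset.mem_univ j), mul_zero]
    rw [if_neg]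
    exact fun h => hj (by omega)

variable (d L) in
/-- The planewaves as elements of the complex `L²` space. -/
noncomputable def planewaveLp (n : Fin d → ℤ) : Lp ℂ 2 (volume : Measure (Torus d L)) :=
  ContinuousMap.toLp (E := ℂ) 2 volume ℂ (planewave n)

lemma coeFn_planewaveLp (n : Fin d → ℤ) : planewaveLp d L n =ᵐ[volume] planewave n :=
  ContinuousMap.coeFn_toLp (𝕜 := ℂ) (p := 2) (volume : Measure (Torus d L)) (planewave n)

lemma inner_planewaveLp (n : Fin d → ℤ) (w : Lp ℂ 2 (volume : Measure (Torus d L))) :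
    inner ℂ (planewaveLp d L n) w = ∫ x, conj (planewave n x) * w x := by
  rw [L2.inner_def]
  refine integral_congr_ae ?_
  filter_upwards [coeFn_planewaveLp (L := L) n] with x h1
  rw [h1, RCLike.inner_apply, mul_comm]

lemma orthonormal_planewaveLp : Orthonormal ℂ (planewaveLp d L) := by
  rw [orthonormal_iff_ite]
  intro n k
  rw [inner_planewaveLp, ← integral_conj_planewave_mul (L := L) n k]
  refine integral_congr_ae ?_
  filter_upwards [coeFn_planewaveLp (L := L) k] with x h1
  rw [h1]

lemma span_planewaveLp_dense :
    (Submodule.span ℂ (Set.range (planewaveLp d L))).topologicalClosure = ⊤ := by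
  unfold planewaveLp
  simpa only [Submodule.map_span, ContinuousLinearMap.coe_coe, ← Set.range_comp,
    Function.comp_def] using
    (ContinuousMap.toLp_denseRange ℂ (volume : Measure (Torus d L)) ℂ
      (by norm_num : (2 : ℝ≥0∞) ≠ ∞)).topologicalClosure_map_submodule span_planewave_dense

variable (d L) in
/-- The Hilbert basis of planewaves of the complex `L²` space. -/
noncomputable def planewaveBasis :
    HilbertBasis (Fin d → ℤ) ℂ (Lp ℂ 2 (volume : Measure (Torus d L))) :=
  HilbertBasis.mk orthonormal_planewaveLp span_planewaveLp_dense.ge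

/-- A real function of `L²`, seen as a complex function. -/
noncomputable def complexify (v : L2 d L) : Lp ℂ 2 (volume : Measure (Torus d L)) :=
  (Lp.memLp v).ofReal.toLp _

lemma coeFn_complexify (v : L2 d L) :
    complexify v =ᵐ[volume] fun x => ((v x : ℝ) : ℂ) :=
  (Lp.memLp v).ofReal.coeFn_toLp

lemma planewaveBasis_inner_complexify (v : L2 d L) (n : Fin d → ℤ) :
    inner ℂ (planewaveBasis d L n) (complexify v) = coeff v n := by
  rw [planewaveBasis, HilbertBasis.coe_mk, inner_planewaveLp, coeff]
  refine integral_congr_ae ?_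
  filter_upwards [coeFn_complexify v] with x h1
  rw [h1]

/-- Parseval's identity. -/
lemma hasSum_conj_coeff_mul (v w : L2 d L) :
    HasSum (fun n => conj (coeff v n) * coeff w n) ((⟪v, w⟫_ℝ : ℝ) : ℂ) := by
  have h := (planewaveBasis d L).hasSum_inner_mul_inner (complexify v) (complexify w)
  simp only [← inner_conj_symm (complexify v) (planewaveBasis d L _),
    planewaveBasis_inner_complexify] at h
  suffices hin : ((⟪v, w⟫_ℝ : ℝ) : ℂ) = inner ℂ (complexify v) (complexify w) by rwa [hin]
  rw [L2.inner_def, L2.inner_def, ← integral_complex_ofReal]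
  refine integral_congr_ae ?_
  filter_upwards [coeFn_complexify v, coeFn_complexify w] with x h1 h2
  rw [h1, h2]
  simp

lemma hasSum_norm_coeff_sq (v : L2 d L) : HasSum (fun n => ‖coeff v n‖ ^ 2) (‖v‖ ^ 2) := by
  have h := hasSum_conj_coeff_mul v v
  rw [real_inner_self_eq_norm_sq] at h
  rw [← Complex.hasSum_ofReal]
  simpa only [Complex.conj_mul', Complex.ofReal_pow] using h

lemma coeff_neg (v : L2 d L) (n : Fin d → ℤ) : coeff v (-n) = conj (coeff v n) := by
  rw [coeff, coeff, ← integral_conj]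
  refine integral_congr_ae (Filter.Eventually.of_forall fun x => ?_)
  simp [planewave_neg]

lemma integrable_conj_planewave_mul (w : Lp ℂ 2 (volume : Measure (Torus d L)))
    (n : Fin d → ℤ) : Integrable (fun x : Torus d L => conj (planewave n x) * w x) := by
  refine ((Lp.memLp w).integrable (by norm_num)).bdd_mul
    (c := ‖(planewave n : C(Torus d L, ℂ))‖) ?_ ?_
  · exact (Complex.continuous_conj.comp (planewave n).continuous).aestronglyMeasurable
  · refine Filter.Eventually.of_forall fun x => ?_
    simpa using (planewave n : C(Torus d L, ℂ)).norm_coe_le_norm x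

/-- The Fourier coefficients of the real part of a complex function. -/
lemma exists_coeff_eq_re (w : Lp ℂ 2 (volume : Measure (Torus d L))) :
    ∃ v : L2 d L, v =ᵐ[volume] (fun x => (w x).re) ∧ ∀ n, coeff v n =
      (inner ℂ (planewaveBasis d L n) w + conj (inner ℂ (planewaveBasis d L (-n)) w)) / 2 := by
  have hre : MemLp (fun x => (w x).re) 2 volume := (Lp.memLp w).re
  refine ⟨hre.toLp _, hre.coeFn_toLp, fun n => ?_⟩
  rw [planewaveBasis, HilbertBasis.coe_mk, inner_planewaveLp, inner_planewaveLp, coeff,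
    ← integral_conj, ← integral_add (integrable_conj_planewave_mul w n), ← integral_div]
  · refine integral_congr_ae ?_
    filter_upwards [hre.coeFn_toLp] with x h1
    rw [h1, Complex.re_eq_add_conj, planewave_neg]
    simp only [map_mul, Complex.conj_conj]
    ring
  · exact Complex.conjCLE.toContinuousLinearMap.integrable_comp
      (integrable_conj_planewave_mul w (-n))

/-- Square summable coefficients with Hermitian symmetry are those of a real function. -/
lemma exists_coeff_eq (c : (Fin d → ℤ) → ℂ) (hc : Summable fun n => ‖c n‖ ^ 2)
    (hsym : ∀ n, c (-n) = conj (c n)) : ∃ v : L2 d L, ∀ n, coeff v n = c n := by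
  have hmem : Memℓp c 2 := memℓp_gen (by simpa using hc)
  obtain ⟨v, -, hv⟩ := exists_coeff_eq_re ((planewaveBasis d L).repr.symm ⟨c, hmem⟩)
  refine ⟨v, fun n => ?_⟩
  simp only [hv, ← HilbertBasis.repr_apply_apply, LinearIsometryEquiv.apply_symm_apply, hsym]
  simp

lemma ext_coeff {v w : L2 d L} (h : ∀ n, coeff v n = coeff w n) : v = w := by
  rw [← sub_eq_zero]
  refine eq_zero_of_coeff _ fun n => ?_
  have := coeff_add v ((-1 : ℝ) • w) n
  rw [coeff_smul, neg_one_smul, ← sub_eq_add_neg] at this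
  rw [this, h]; simp

lemma coeff_sub (v w : L2 d L) (n : Fin d → ℤ) : coeff (v - w) n = coeff v n - coeff w n := by
  rw [eq_sub_iff_add_eq, ← coeff_add, sub_add_cancel]

/-- The bounded Fourier multiplier with symbol `μ`. -/
lemma exists_multiplier (μ : (Fin d → ℤ) → ℂ) (hμ : ∀ n, ‖μ n‖ ≤ 1)
    (hsym : ∀ n, μ (-n) = conj (μ n)) :
    ∃ B : L2 d L →L[ℝ] L2 d L, (∀ v, ‖B v‖ ≤ ‖v‖) ∧ ∀ v n, coeff (B v) n = μ n * coeff v n := by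
  have hle : ∀ (v : L2 d L) n, ‖μ n * coeff v n‖ ^ 2 ≤ ‖coeff v n‖ ^ 2 := fun v n => by
    rw [norm_mul]
    exact pow_le_pow_left₀ (by positivity) (mul_le_of_le_one_left (norm_nonneg _) (hμ n)) 2
  have hex : ∀ v : L2 d L, ∃ w : L2 d L, ∀ n, coeff w n = μ n * coeff v n := fun v =>
    exists_coeff_eq _ (.of_nonneg_of_le (fun _ => sq_nonneg _) (hle v)
      (hasSum_norm_coeff_sq v).summable) fun n => by rw [hsym, coeff_neg, map_mul]
  choose F hF using hex
  have hnorm : ∀ v, ‖F v‖ ≤ ‖v‖ := fun v => by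
    refine le_of_sq_le_sq ?_ (norm_nonneg v)
    refine hasSum_le (fun n => ?_) (hasSum_norm_coeff_sq (F v)) (hasSum_norm_coeff_sq v)
    rw [hF]; exact hle v n
  let T : L2 d L →ₗ[ℝ] L2 d L :=
    { toFun := F
      map_add' v w := ext_coeff fun n => by simp only [coeff_add, hF]; ring
      map_smul' c v := ext_coeff fun n => by simp only [coeff_smul, hF, RingHom.id_apply]; ring }
  exact ⟨T.mkContinuous 1 fun v => by rw [one_mul]; exact hnorm v, hnorm, hF⟩

variable (d L) in
/-- `(-Δ + 1)^{-1/2}`. -/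
lemma exists_resolvent_sqrt :
    ∃ B : L2 d L →L[ℝ] L2 d L, (∀ v, ‖B v‖ ≤ ‖v‖) ∧ ∀ v n,
      coeff (B v) n = (((Real.sqrt (1 + waveSq L n))⁻¹ : ℝ) : ℂ) * coeff v n := by
  refine exists_multiplier _ (fun n => ?_) fun n => by rw [waveSq_neg, Complex.conj_ofReal]
  rw [Complex.norm_real, Real.norm_of_nonneg (by positivity)]
  refine inv_le_one_of_one_le₀ (Real.one_le_sqrt.mpr ?_)
  linarith [waveSq_nonneg (L := L) n]

lemma isPositive_of_coeff_eq {B : L2 d L →L[ℝ] L2 d L} {μ : (Fin d → ℤ) → ℝ} (hμ : ∀ n, 0 ≤ μ n)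
    (hB : ∀ v n, coeff (B v) n = (μ n : ℂ) * coeff v n) : B.IsPositive := by
  rw [ContinuousLinearMap.isPositive_iff]
  refine ⟨fun v w => ?_, fun v => ?_⟩
  · change ⟪B v, w⟫_ℝ = ⟪v, B w⟫_ℝ
    have h1 := hasSum_conj_coeff_mul (B v) w
    have h2 := hasSum_conj_coeff_mul v (B w)
    have : ∀ n, conj (coeff (B v) n) * coeff w n = conj (coeff v n) * coeff (B w) n := fun n => by
      rw [hB, hB, map_mul, Complex.conj_ofReal]; ring
    simp only [this] at h1
    exact_mod_cast h1.unique h2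
  · have h1 := hasSum_conj_coeff_mul (B v) v
    have h2 : HasSum (fun n => μ n * ‖coeff v n‖ ^ 2) ⟪B v, v⟫_ℝ := by
      rw [← Complex.hasSum_ofReal]
      convert h1 using 2 with n
      rw [hB, map_mul, Complex.conj_ofReal, mul_assoc, Complex.conj_mul']
      push_cast; rfl
    exact h2.nonneg fun n => mul_nonneg (hμ n) (sq_nonneg _)

lemma mem_graph_negLaplacianAddOne (v f : L2 d L) :
    (v, f) ∈ (negLaplacianAddOne d L).graph ↔
      ∀ n, coeff f n = ((1 + waveSq L n : ℝ) : ℂ) * coeff v n := by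
  rw [negLaplacianAddOne, mem_graph_vadd, negLaplacian, mem_graph_multiplier]
  refine forall_congr' fun n => ?_
  rw [coeff_sub, LinearMap.id_apply, sub_eq_iff_eq_add]
  push_cast
  rw [add_mul, one_mul, add_comm]

end PlanewaveBasis

section Residual

variable {d : ℕ} {L : ℝ} [Fact (0 < L)]

/-! ### The bounded perturbation `V - 1` of `-Δ + 1` -/

/-- Multiplication by `V - 1`. -/
noncomputable def potSubOne (V : Linf d L) : L2 d L →L[ℝ] L2 d L :=
  (potMul V).mkContinuous ‖V‖ (fun v => Lp.norm_smul_le V v) - 1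

lemma potSubOne_apply (V : Linf d L) (v : L2 d L) : potSubOne V v = potMul V v - v := rfl

lemma coeFn_potMul (V : Linf d L) (v : L2 d L) :
    potMul V v =ᵐ[volume] fun x => V x * v x :=
  Lp.coeFn_lpSMul V v

lemma inner_potMul (V : Linf d L) (v w : L2 d L) :
    ⟪potMul V v, w⟫_ℝ = ⟪v, potMul V w⟫_ℝ := by
  rw [L2.inner_def, L2.inner_def]
  refine integral_congr_ae ?_
  filter_upwards [coeFn_potMul V v, coeFn_potMul V w] with x h1 h2
  rw [h1, h2]
  simp only [RCLike.inner_apply, conj_trivial]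
  ring

lemma isPositive_potSubOne (V : Linf d L) (hV : ∀ᵐ x ∂(volume : Measure (Torus d L)), 1 ≤ V x) :
    (potSubOne V).IsPositive := by
  rw [ContinuousLinearMap.isPositive_iff]
  refine ⟨fun v w => ?_, fun v => ?_⟩
  · change ⟪potSubOne V v, w⟫_ℝ = ⟪v, potSubOne V w⟫_ℝ
    simp only [potSubOne_apply, inner_sub_left, inner_sub_right, inner_potMul]
  · rw [L2.inner_def]
    refine integral_nonneg_of_ae ?_
    filter_upwards [hV, coeFn_potMul V v, Lp.coeFn_sub (potMul V v) v] with x h1 h2 h3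
    rw [potSubOne_apply, h3, Pi.sub_apply, h2]
    simp only [RCLike.inner_apply, conj_trivial, Pi.zero_apply]
    nlinarith [mul_self_nonneg (v x)]

/-- The splitting `-Δ + V = (-Δ + 1) + (V - 1)` turns `V ≥ 1` into positivity of the perturbation.
-/
lemma mem_graph_schrodinger (V : Linf d L) (v f : L2 d L) :
    (v, f) ∈ (schrodinger V).graph ↔ (v, f - potSubOne V v) ∈ (negLaplacianAddOne d L).graph := by
  rw [schrodinger, negLaplacianAddOne, mem_graph_vadd, mem_graph_vadd, potSubOne_apply,
    LinearMap.id_apply, sub_sub, sub_add_cancel]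

/-! ### The range of `(-Δ + 1)^{-1/2}` -/

lemma mem_graph_of_resolvent_sqrt {B : L2 d L →L[ℝ] L2 d L} (hB : ∀ v n,
    coeff (B v) n = (((Real.sqrt (1 + waveSq L n))⁻¹ : ℝ) : ℂ) * coeff v n) (v f : L2 d L) :
    (v, f) ∈ (negLaplacianAddOne d L).graph ↔ v = B (B f) := by
  have hsq : ∀ n : Fin d → ℤ, (((Real.sqrt (1 + waveSq L n))⁻¹ : ℝ) : ℂ) *
      ((((Real.sqrt (1 + waveSq L n))⁻¹ : ℝ) : ℂ)) * ((1 + waveSq L n : ℝ) : ℂ) = 1 := fun n => by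
    have h := one_le_sqrt_waveSq (L := L) n
    rw [← Complex.ofReal_mul, ← Complex.ofReal_mul, ← Complex.ofReal_one, ← mul_inv, ← sq,
      sq_sqrt_waveSq, inv_mul_cancel₀]
    linarith [waveSq_nonneg (L := L) n]
  rw [mem_graph_negLaplacianAddOne]
  constructor
  · intro h
    refine ext_coeff fun n => ?_
    rw [hB, hB, h, ← mul_assoc, ← mul_assoc, hsq, one_mul]
  · rintro rfl n
    rw [hB, hB]
    linear_combination (-coeff f n) * hsq n

lemma injective_of_resolvent_sqrt {B : L2 d L →L[ℝ] L2 d L} (hB : ∀ v n,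
    coeff (B v) n = (((Real.sqrt (1 + waveSq L n))⁻¹ : ℝ) : ℂ) * coeff v n) :
    Function.Injective B := by
  intro v w h
  refine ext_coeff fun n => ?_
  have h1 := hB v n
  rw [h, hB] at h1
  have h2 : (((Real.sqrt (1 + waveSq L n))⁻¹ : ℝ) : ℂ) ≠ 0 := by
    have := one_le_sqrt_waveSq (L := L) n
    rw [Complex.ofReal_ne_zero]; positivity
  exact (mul_left_cancel₀ h2 h1).symm

/-- `H¹` is contained in the range of `B`: the preimage has coefficients `(1 + |k|²)^{1/2} v̂_k`. -/
lemma exists_resolvent_sqrt_eq {B : L2 d L →L[ℝ] L2 d L} (hB : ∀ v n,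
    coeff (B v) n = (((Real.sqrt (1 + waveSq L n))⁻¹ : ℝ) : ℂ) * coeff v n) {v : L2 d L}
    (hv : Summable fun n => (1 + waveSq L n) * ‖coeff v n‖ ^ 2) : ∃ z, B z = v := by
  obtain ⟨z, hz⟩ := exists_coeff_eq (d := d) (L := L)
    (fun n => ((Real.sqrt (1 + waveSq L n) : ℝ) : ℂ) * coeff v n) (by
      convert hv using 2 with n
      rw [norm_mul, mul_pow, Complex.norm_real, Real.norm_of_nonneg (Real.sqrt_nonneg _),
        sq_sqrt_waveSq]) fun n => by
      simp only [waveSq_neg, coeff_neg, map_mul, Complex.conj_ofReal]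
  refine ⟨z, ext_coeff fun n => ?_⟩
  have h := one_le_sqrt_waveSq (L := L) n
  rw [hB, hz, ← mul_assoc, ← Complex.ofReal_mul, inv_mul_cancel₀ (by positivity),
    Complex.ofReal_one, one_mul]

lemma tsum_ofReal_norm_coeff_sq (v : L2 d L) :
    ∑' n, ENNReal.ofReal (‖coeff v n‖ ^ 2) = ‖v‖ₑ ^ 2 := by
  rw [enorm_sq_eq_ofReal, ← (hasSum_norm_coeff_sq v).tsum_eq,
    ENNReal.ofReal_tsum_of_nonneg (fun _ => sq_nonneg _) (hasSum_norm_coeff_sq v).summable]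

lemma sobolevNorm_one_sq {B : L2 d L →L[ℝ] L2 d L} (hB : ∀ v n,
    coeff (B v) n = (((Real.sqrt (1 + waveSq L n))⁻¹ : ℝ) : ℂ) * coeff v n) (z : L2 d L) :
    sobolevNorm L 1 (coeff (B z)) ^ 2 = ‖z‖ₑ ^ 2 := by
  rw [sobolevNorm_sq, ← tsum_ofReal_norm_coeff_sq]
  refine tsum_congr fun n => ?_
  have h := one_le_sqrt_waveSq (L := L) n
  rw [hB, norm_mul, mul_pow, Complex.norm_real, Real.norm_of_nonneg (by positivity), Real.rpow_one,
    inv_pow, sq_sqrt_waveSq, mul_inv_cancel_left₀]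
  linarith [waveSq_nonneg (L := L) n]

lemma sobolevNorm_neg_one_sq {B : L2 d L →L[ℝ] L2 d L} (hB : ∀ v n,
    coeff (B v) n = (((Real.sqrt (1 + waveSq L n))⁻¹ : ℝ) : ℂ) * coeff v n) (r : L2 d L) :
    sobolevNorm L (-1) (coeff r) ^ 2 = ‖B r‖ₑ ^ 2 := by
  rw [sobolevNorm_sq, ← tsum_ofReal_norm_coeff_sq]
  refine tsum_congr fun n => ?_
  have h := one_le_sqrt_waveSq (L := L) n
  rw [hB, norm_mul, mul_pow, Complex.norm_real, Real.norm_of_nonneg (by positivity),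
    Real.rpow_neg_one, inv_pow, sq_sqrt_waveSq]

lemma summable_of_sobolevNorm {v : L2 d L} (hv : sobolevNorm L 1 (coeff v) ≠ ∞) :
    Summable fun n => (1 + waveSq L n) * ‖coeff v n‖ ^ 2 := by
  have h : sobolevNorm L 1 (coeff v) ^ 2 ≠ ∞ := ENNReal.pow_ne_top hv
  rw [sobolevNorm_sq] at h
  convert ENNReal.summable_toReal h using 2 with n
  have := waveSq_nonneg (L := L) n
  rw [Real.rpow_one, ENNReal.toReal_ofReal (by positivity)]

/-! ### Real and imaginary parts of planewaves -/

lemma coeFn_rePlanewave (n : Fin d → ℤ) :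
    (rePlanewave n : L2 d L) =ᵐ[volume] fun x => (planewave n x).re :=
  ContinuousMap.coeFn_toLp (𝕜 := ℝ) (p := 2) (volume : Measure (Torus d L)) _

lemma coeFn_imPlanewave (n : Fin d → ℤ) :
    (imPlanewave n : L2 d L) =ᵐ[volume] fun x => (planewave n x).im :=
  ContinuousMap.coeFn_toLp (𝕜 := ℝ) (p := 2) (volume : Measure (Torus d L)) _

/-- This matches the formula of `dualCoeff`, so the functional `(v, ·)` has the dual coefficients
`v̂_k`. -/
lemma coeff_eq_inner (v : L2 d L) (n : Fin d → ℤ) :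
    coeff v n = (⟪v, rePlanewave n⟫_ℝ : ℂ) - Complex.I * (⟪v, imPlanewave n⟫_ℝ : ℂ) := by
  rw [L2.inner_def, L2.inner_def, ← integral_complex_ofReal, ← integral_complex_ofReal,
    ← integral_const_mul, ← integral_sub (L2.integrable_inner v _).ofReal
      ((L2.integrable_inner v _).ofReal.const_mul _), coeff]
  refine integral_congr_ae ?_
  filter_upwards [coeFn_rePlanewave (L := L) n, coeFn_imPlanewave (L := L) n] with x h1 h2
  rw [h1, h2]
  apply Complex.ext <;> simp

/-- Real functions whose Fourier coefficients are supported at `±n` are in `H¹_#`. -/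
lemma exists_resolvent_sqrt_eq_re {B : L2 d L →L[ℝ] L2 d L} (hB : ∀ v n,
    coeff (B v) n = (((Real.sqrt (1 + waveSq L n))⁻¹ : ℝ) : ℂ) * coeff v n) (n : Fin d → ℤ)
    (c : ℂ) {v : L2 d L} (hv : v =ᵐ[volume] fun x => (c * planewave n x).re) : ∃ z, B z = v := by
  obtain ⟨v', hv', hcoeff⟩ := exists_coeff_eq_re (c • planewaveLp d L n)
  have hvv : v' = v := by
    refine Lp.ext ?_
    filter_upwards [hv, hv', Lp.coeFn_smul c (planewaveLp d L n), coeFn_planewaveLp (L := L) n]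
      with x h1 h2 h3 h4
    rw [h1, h2, h3, Pi.smul_apply, h4, smul_eq_mul]
  subst hvv
  refine exists_resolvent_sqrt_eq hB (summable_of_ne_finset_zero (s := {n, -n}) fun k hk => ?_)
  simp only [Finset.mem_insert, Finset.mem_singleton, not_or] at hk
  have h1 : ∀ k, k ≠ n → inner ℂ (planewaveBasis d L k) (c • planewaveLp d L n) = 0 :=
    fun k hk => by
    rw [inner_smul_right, planewaveBasis, HilbertBasis.coe_mk, orthonormal_planewaveLp.2 hk,
      mul_zero]
  rw [hcoeff, h1 k hk.1, h1 (-k) fun h => hk.2 (by rw [← h, neg_neg])]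
  simp

/-! ### Functions of the planewave space -/

/-- On the frequencies of `V_N` the symbol is at most `1 + (2πN/L)²`. The growth bound `1 + |k|²`
covers both `-Δ` and `∂_j`. -/
lemma exists_mem_graph_multiplier {N : ℕ} {u : L2 d L} (hu : u ∈ planewaveSpace d L N)
    {μ : (Fin d → ℤ) → ℂ} (hμ : ∀ n, ‖μ n‖ ≤ 1 + waveSq L n) (hsym : ∀ n, μ (-n) = conj (μ n)) :
    ∃ f, (u, f) ∈ (multiplier μ).graph := by
  obtain ⟨f, hf⟩ := exists_coeff_eq (d := d) (L := L) (fun n => μ n * coeff u n) (by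
    refine .of_nonneg_of_le (fun _ => sq_nonneg _) (fun n => ?_)
      ((hasSum_norm_coeff_sq u).summable.mul_left ((1 + (2 * Real.pi / L * N) ^ 2) ^ 2))
    by_cases hn : 2 * Real.pi / L * N < Real.sqrt (waveSq L n)
    · rw [hu n hn]; simp
    · rw [norm_mul, mul_pow]
      refine mul_le_mul_of_nonneg_right (pow_le_pow_left₀ (norm_nonneg _)
        ((hμ n).trans ?_) 2) (sq_nonneg _)
      have := pow_le_pow_left₀ (Real.sqrt_nonneg _) (not_lt.mp hn) 2
      rw [Real.sq_sqrt (waveSq_nonneg n)] at this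
      linarith) fun n => by rw [hsym, coeff_neg, map_mul]
  exact ⟨f, (mem_graph_multiplier μ u f).mpr hf⟩

lemma exists_mem_graph_negLaplacian {N : ℕ} {u : L2 d L} (hu : u ∈ planewaveSpace d L N) :
    ∃ f, (u, f) ∈ (negLaplacian d L).graph := by
  refine exists_mem_graph_multiplier hu (fun n => ?_) fun n => by
    rw [waveSq_neg, Complex.conj_ofReal]
  rw [Complex.norm_real, Real.norm_of_nonneg (waveSq_nonneg n)]
  linarith

lemma exists_mem_graph_partialDeriv {N : ℕ} {u : L2 d L} (hu : u ∈ planewaveSpace d L N)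
    (j : Fin d) : ∃ f, (u, f) ∈ (partialDeriv j).graph := by
  refine exists_mem_graph_multiplier hu (fun n => ?_) fun n => by
    rw [map_mul, Complex.conj_I, Complex.conj_ofReal]
    simp [waveVec]
  rw [norm_mul, Complex.norm_I, one_mul, Complex.norm_real, Real.norm_eq_abs]
  have h1 : waveVec L n j ^ 2 ≤ waveSq L n :=
    Finset.single_le_sum (f := fun j => waveVec L n j ^ 2) (fun _ _ => sq_nonneg _)
      (Finset.mem_univ j)
  rw [← sq_abs] at h1
  nlinarith [sq_nonneg (|waveVec L n j| - 1)]

/-- Integration by parts on the Fourier side: `∑_j conj(i k_j) (i k_j) = |k|²`. -/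
lemma gradInner_eq_inner {N : ℕ} {u v f : L2 d L} (hu : u ∈ planewaveSpace d L N)
    (hv : v ∈ planewaveSpace d L N) (hf : (u, f) ∈ (negLaplacian d L).graph) :
    gradInner u v = ⟪f, v⟫_ℝ := by
  choose p hp using exists_mem_graph_partialDeriv hu
  choose q hq using exists_mem_graph_partialDeriv hv
  have h1 : HasSum (fun n => ∑ j, conj (coeff (p j) n) * coeff (q j) n)
      ((gradInner u v : ℝ) : ℂ) := by
    simp only [gradInner, app_eq_of_mem_graph (hp _), app_eq_of_mem_graph (hq _),
      Complex.ofReal_sum]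
    exact hasSum_sum fun j _ => hasSum_conj_coeff_mul (p j) (q j)
  have h2 := hasSum_conj_coeff_mul f v
  have : ∀ n, ∑ j, conj (coeff (p j) n) * coeff (q j) n = conj (coeff f n) * coeff v n := by
    intro n
    rw [(mem_graph_multiplier _ _ _).mp hf n, waveSq, Complex.ofReal_sum, map_mul, map_sum,
      Finset.sum_mul, Finset.sum_mul]
    refine Finset.sum_congr rfl fun j _ => ?_
    rw [(mem_graph_multiplier _ _ _).mp (hp j) n, (mem_graph_multiplier _ _ _).mp (hq j) n]
    simp only [map_mul, Complex.conj_I, Complex.conj_ofReal, Complex.ofReal_pow, map_pow]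
    linear_combination (-(waveVec L n j : ℂ) ^ 2 * conj (coeff u n) * coeff v n) * Complex.I_sq
  simp only [this] at h1
  exact_mod_cast h1.unique h2

/-! ### The residual functionals -/

/-- The residual is represented by `lam u - A u`. -/
lemma residual_eq_inner {H : Type*} [NormedAddCommGroup H] [InnerProductSpace ℝ H]
    {A : H →ₗ.[ℝ] H} (hA : ∀ x y, (x, y) ∈ A.graph ↔ x = invSqrt A (invSqrt A y))
    (hS : (invSqrt A).IsPositive) (hinj : Function.Injective (invSqrt A)) {u f : H}
    (hf : (u, f) ∈ A.graph) (lam : ℝ) (z : H) :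
    residual A u lam (invSqrt A z) = -⟪f - lam • u, invSqrt A z⟫_ℝ := by
  have hu := (hA _ _).mp hf
  have h1 : app (sqrtOp A) u = invSqrt A f := by
    conv_lhs => rw [hu]
    exact app_sqrtOp hinj _
  rw [residual, h1, app_sqrtOp hinj, hS.inner_left_eq_inner_right, inner_sub_left,
    real_inner_smul_left]
  ring

lemma sobolevNorm_dualCoeff_sq {B : L2 d L →L[ℝ] L2 d L} (hB : ∀ v n,
    coeff (B v) n = (((Real.sqrt (1 + waveSq L n))⁻¹ : ℝ) : ℂ) * coeff v n) {ℓ : L2 d L → ℝ}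
    {r : L2 d L} (hℓ : ∀ z, ℓ (B z) = -⟪r, B z⟫_ℝ) :
    sobolevNorm L (-1) (dualCoeff ℓ) ^ 2 = ‖B r‖ₑ ^ 2 := by
  have hc : ∀ n, dualCoeff ℓ n = -coeff r n := fun n => by
    -- `ℓ` is known only on the range of `B`, which contains `Re e_k` and `Im e_k = Re(-i e_k)`.
    obtain ⟨z, hz⟩ := exists_resolvent_sqrt_eq_re hB n 1 (v := rePlanewave n) (by
      simpa using coeFn_rePlanewave n)
    obtain ⟨z', hz'⟩ := exists_resolvent_sqrt_eq_re hB n (-Complex.I) (v := imPlanewave n) (by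
      simpa using coeFn_imPlanewave n)
    rw [dualCoeff, ← hz, ← hz', hℓ, hℓ, hz, hz', coeff_eq_inner]
    push_cast
    ring
  rw [← sobolevNorm_neg_one_sq hB, sobolevNorm_sq, sobolevNorm_sq]
  simp only [hc, norm_neg]

/-- `B` is an isometry of `L²` onto `H¹`, so with `v = Bz` this is the supremum of `(Br, z)²` over
unit `z`: Cauchy–Schwarz, attained at `Br / ‖Br‖`. -/
lemma iSup_sq_eq {B : L2 d L →L[ℝ] L2 d L} (hB : ∀ v n,
    coeff (B v) n = (((Real.sqrt (1 + waveSq L n))⁻¹ : ℝ) : ℂ) * coeff v n) (hBpos : B.IsPositive)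
    {ℓ : L2 d L → ℝ} {r : L2 d L} (hℓ : ∀ z, ℓ (B z) = -⟪r, B z⟫_ℝ) :
    ⨆ v ∈ {v : L2 d L | sobolevNorm L 1 (coeff v) = 1}, ENNReal.ofReal (ℓ v ^ 2) =
      ‖B r‖ₑ ^ 2 := by
  have hsq : ∀ z, ℓ (B z) ^ 2 = ⟪B r, z⟫_ℝ ^ 2 := fun z => by
    rw [hℓ, neg_sq, hBpos.inner_left_eq_inner_right]
  have hnorm : ∀ z, sobolevNorm L 1 (coeff (B z)) = 1 ↔ ‖z‖ = 1 := fun z => by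
    have h := sobolevNorm_one_sq hB z
    have h' : sobolevNorm L 1 (coeff (B z)) = ‖z‖ₑ :=
      (ENNReal.pow_right_strictMono two_ne_zero).injective h
    rw [h', ← ofReal_norm, ENNReal.ofReal_eq_one]
  rw [enorm_sq_eq_ofReal]
  refine le_antisymm (iSup₂_le fun v hv => ENNReal.ofReal_le_ofReal ?_) ?_
  -- Norm `1` is finite, so `v` lies in `H¹`; values of `ℓ` elsewhere play no role.
  · obtain ⟨z, rfl⟩ := exists_resolvent_sqrt_eq hB
      (summable_of_sobolevNorm (v := v) (by rw [hv]; exact ENNReal.one_ne_top))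
    have hz := (hnorm z).mp hv
    rw [hsq, sq_le_sq, abs_norm]
    simpa [hz] using abs_real_inner_le_norm (B r) z
  · by_cases hr : B r = 0
    · simp [hr]
    · have hr' : ‖B r‖ ≠ 0 := norm_ne_zero_iff.mpr hr
      refine le_iSup₂_of_le (B (‖B r‖⁻¹ • B r)) ((hnorm _).mpr ?_) (ENNReal.ofReal_le_ofReal ?_)
      · rw [norm_smul, norm_inv, norm_norm, inv_mul_cancel₀ hr']
      · rw [hsq, real_inner_smul_right, real_inner_self_eq_norm_sq, sq ‖B r‖, ← mul_assoc,
          inv_mul_cancel₀ hr', one_mul, sq]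

end Residual

end PeriodicSchrodinger

/-! ### Assembly of the chain of identities -/

open PeriodicSchrodinger in
theorem mainTheorem12 {d : ℕ} {L : ℝ} [Fact (0 < L)]
    (V : Linf d L) (hV : ∀ᵐ x ∂(volume : Measure (Torus d L)), 1 ≤ V x)
    (N m M : ℕ) (u : ℕ → L2 d L) (lam : ℕ → ℝ)
    (hu : ∀ i ∈ Finset.Icc m M, u i ∈ planewaveSpace d L N)
    (horth : ∀ i ∈ Finset.Icc m M, ∀ j ∈ Finset.Icc m M, ⟪u i, u j⟫_ℝ = if i = j then 1 else 0)
    (heig : ∀ i ∈ Finset.Icc m M, ∀ v ∈ planewaveSpace d L N,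
      gradInner (u i) v + ⟪u i, potMul V v⟫_ℝ = lam i * ⟪u i, v⟫_ℝ)
    {ι : Type*} (e : HilbertBasis ι ℝ (L2 d L)) :
    hsNorm e (clusterResidual (schrodinger V) (densityMatrix u m M)) ^ 2
        = hsNorm e (invSqrt (schrodinger V) ∘L
            strongResidual (schrodinger V) (densityMatrix u m M)) ^ 2 ∧
    hsNorm e (invSqrt (schrodinger V) ∘L
        strongResidual (schrodinger V) (densityMatrix u m M)) ^ 2
      ≤ hsNorm e (invSqrt (negLaplacianAddOne d L) ∘L
          strongResidual (schrodinger V) (densityMatrix u m M)) ^ 2 ∧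
    hsNorm e (invSqrt (negLaplacianAddOne d L) ∘L
        strongResidual (schrodinger V) (densityMatrix u m M)) ^ 2
      = ∑ i ∈ Finset.Icc m M,
          sobolevNorm L (-1) (dualCoeff (residual (schrodinger V) (u i) (lam i))) ^ 2 ∧
    ∑ i ∈ Finset.Icc m M,
        sobolevNorm L (-1) (dualCoeff (residual (schrodinger V) (u i) (lam i))) ^ 2
      = ∑ i ∈ Finset.Icc m M, ⨆ v ∈ {v : L2 d L | sobolevNorm L 1 (coeff v) = 1},
          ENNReal.ofReal (residual (schrodinger V) (u i) (lam i) v ^ 2) := by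
  obtain ⟨B, hB1, hB⟩ := exists_resolvent_sqrt d L
  have hBpos : B.IsPositive := isPositive_of_coeff_eq (fun n => by positivity) hB
  have hK := mem_graph_of_resolvent_sqrt hB
  obtain ⟨hA, hS, hinj, hle, hrange⟩ := invSqrt_of_bounded_perturbation hBpos hB1
    (injective_of_resolvent_sqrt hB) (isPositive_potSubOne V hV) hK (mem_graph_schrodinger V)
  have hdom : ∀ i, ∃ f, i ∈ Finset.Icc m M → (u i, f) ∈ (negLaplacian d L).graph := fun i => by
    by_cases hi : i ∈ Finset.Icc m M
    · obtain ⟨f, hf⟩ := exists_mem_graph_negLaplacian (hu i hi)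
      exact ⟨f, fun _ => hf⟩
    · exact ⟨0, fun h => absurd h hi⟩
  choose g hg using hdom
  set f : ℕ → L2 d L := fun i => g i + potMul V (u i) with hf
  have hfA : ∀ i ∈ Finset.Icc m M, (u i, f i) ∈ (schrodinger V).graph := fun i hi => by
    rw [schrodinger, mem_graph_vadd, hf]
    simpa using hg i hi
  have hfv : ∀ i ∈ Finset.Icc m M, ∀ v ∈ planewaveSpace d L N, ⟪f i, v⟫_ℝ = lam i * ⟪u i, v⟫_ℝ :=
    fun i hi v hv => by
      rw [← heig i hi v hv, gradInner_eq_inner (hu i hi) hv (hg i hi), hf, inner_add_left,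
        inner_potMul]
  obtain ⟨hres, hAγ⟩ := clusterResidual_eq hA hS hinj hfA
  set r : ℕ → L2 d L := fun i => f i - lam i • u i with hr
  have hstrong : ∀ v, strongResidual (schrodinger V) (densityMatrix u m M) v =
      ∑ i ∈ Finset.Icc m M, ⟪u i, v⟫_ℝ • r i := fun v => by
    -- The Galerkin equation tested with `u j` gives `(f i, u j) = lam i δ_ij`.
    have hγf : ∀ i ∈ Finset.Icc m M, densityMatrix u m M (f i) = lam i • u i := fun i hi => by
      rw [densityMatrix_apply, Finset.sum_eq_single_of_mem i hi fun j hj hji => ?_]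
      · rw [real_inner_comm, hfv i hi _ (hu i hi), horth i hi i hi, if_pos rfl, mul_one]
      · rw [real_inner_comm, hfv i hi _ (hu j hj), horth i hi j hj, if_neg hji.symm, mul_zero,
          zero_smul]
    rw [strongResidual, ContinuousLinearMap.comp_apply, hAγ, map_sum]
    refine Finset.sum_congr rfl fun i hi => ?_
    rw [map_smul, sub_apply, one_apply_eq_self, hγf i hi]
  have hresid : ∀ i ∈ Finset.Icc m M, ∀ z,
      residual (schrodinger V) (u i) (lam i) (B z) = -⟪r i, B z⟫_ℝ := fun i hi z => by
    -- `residual_eq_inner` holds on the range of `A^{-1/2}`, which contains that of `B`.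
    obtain ⟨z', hz'⟩ := hrange z
    rw [← hz']
    exact residual_eq_inner hA hS hinj (hfA i hi) (lam i) z'
  refine ⟨by rw [hres], ?_, ?_, ?_⟩
  · rw [hsNorm_sq, hsNorm_sq]
    refine ENNReal.tsum_le_tsum fun k => pow_le_pow_left' ?_ 2
    rw [ContinuousLinearMap.comp_apply, ContinuousLinearMap.comp_apply, ← ofReal_norm,
      ← ofReal_norm, norm_invSqrt_of_sq hBpos hK]
    exact ENNReal.ofReal_le_ofReal (hle _)
  · rw [hsNorm_sq_of_orthonormal e horth (w := fun i => invSqrt (negLaplacianAddOne d L) (r i))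
      fun v => by rw [ContinuousLinearMap.comp_apply, hstrong, map_sum]; simp only [map_smul]]
    refine Finset.sum_congr rfl fun i hi => ?_
    rw [sobolevNorm_dualCoeff_sq hB (hresid i hi), ← ofReal_norm, ← ofReal_norm,
      norm_invSqrt_of_sq hBpos hK]
  · refine Finset.sum_congr rfl fun i hi => ?_
    rw [sobolevNorm_dualCoeff_sq hB (hresid i hi), iSup_sq_eq hB hBpos (hresid i hi)]
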